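/- Let $\mathbb K$ be a field of characteristic zero, $\mathcal O$ a commutative unital $\mathbb K$-algebra, and $(\mathcal A,[\cdot,\cdot]_{\mathcal A},\rho_{\mathcal A})$ a Lie-Rinehart algebra over $\mathcal O$, i.e. an $\mathcal O$-module with a $\mathbb K$-Lie bracket and an $\mathcal O$-linear Lie algebra morphism (the anchor) $\rho_{\mathcal A}\colon\mathcal A\to\mathrm{Der}_{\mathbb K}(\mathcal O)$ such that $[a,fb]_{\mathcal A}=\rho_{\mathcal A}(a)[f]\,b+f[a,b]_{\mathcal A}$. A Lie algebroid is a Lie-Rinehart algebra whose underlying $\mathcal O$-module is projective. A (negatively graded) Lie $\infty$-algebroid over $\mathcal O$ is a collection $\mathcal E=(\mathcal E_i)_{i\le -1}$ of projective $\mathcal O$-modules with graded symmetric $\mathbb K$-multilinear brackets $\ell_k$ ($k\ge 1$) of arity $k$ and degree $+1$, and an $\mathcal O$-linear anchor $\rho_{\mathcal E}\colon\mathcal E_{-1}\to\mathrm{Der}_{\mathbb K}(\mathcal O)$, extended by zero to $\mathcal E_{-i}$ for $i\ge 2$, such that 1. for all $n\ge 1$ and all homogeneous $x_1,\dots,x_n$,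 $$\sum_{i=1}^{n}\sum_{\sigma\in\mathfrak S_{i,n-i}}\epsilon(\sigma)\,\ell_{n-i+1}\big(\ell_i(x_{\sigma(1)},\dots,x_{\sigma(i)}),x_{\sigma(i+1)},\dots,x_{\sigma(n)}\big)=0,$$ where $\mathfrak S_{i,n-i}$ is the set of $(i,n-i)$-shuffles and $\epsilon(\sigma)$ is the Koszul sign; 2. $\ell_k$ is $\mathcal O$-multilinear for $k\neq 2$, and $\ell_2(x,fy)=\rho_{\mathcal E}(x)[f]\,y+f\,\ell_2(x,y)$ for all $x,y\in\mathcal E$, $f\in\mathcal O$; 3. $\rho_{\mathcal E}\circ\ell_1=0$ on $\mathcal E_{-2}$, and $\rho_{\mathcal E}(\ell_2(x,y))=[\rho_{\mathcal E}(x),\rho_{\mathcal E}(y)]$ for $x,y\in\mathcal E_{-1}$. It is universal for $\mathcal A$ through an $\mathcal O$-linear map $\pi\colon\mathcal E_{-1}\to\mathcal A$ if $\rho_{\mathcal A}\circ\pi=\rho_{\mathcal E}$, $\pi(\ell_2(x,y))=[\pi(x),\pi(y)]_{\mathcal A}$ for all $x,y\in\mathcal E_{-1}$, and $\cdots\xrightarrow{\ell_1}\mathcal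 E_{-2}\xrightarrow{\ell_1}\mathcal E_{-1}\xrightarrow{\pi}\mathcal A\to 0$ is exact. **Proposition.** Let $\cdots\xrightarrow{\ell_1}\mathcal E_{-2}\xrightarrow{\ell_1}\mathcal E_{-1}\xrightarrow{\pi}\mathcal A\to 0$ be a resolution of $\mathcal A$ by free $\mathcal O$-modules. Suppose that $\mathcal E_{-1}$ carries a Lie algebroid structure with bracket $[\cdot,\cdot]$ for which $\pi$ is a morphism of Lie-Rinehart algebras over $\mathcal O$, i.e. $\pi$ preserves brackets and anchors. Then there exists a Lie $\infty$-algebroid structure on $\mathcal E$ whose unary bracket is the given $\ell_1$, which is universal for $\mathcal A$ through the given $\pi$, whose binary bracket coincides with $[\cdot,\cdot]$ on $\mathcal E_{-1}$, and such that for every $k\ge 3$ the bracket $\ell_k$ vanishes on $\bigodot^k\mathcal E_{-1}$, i.e. $\ell_k(x_1,\dots,x_k)=0$ for all $x_1,\dots,x_k\in\mathcal E_{-1}$. -/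

import Mathlib

/-- The Koszul sign `ε(σ; x₁, …, xₙ)` of a permutation `σ` for homogeneous elements `x_a` of degree
`d a`, i.e. the sign with `x_{σ(1)} ⊙ ⋯ ⊙ x_{σ(n)} = ε(σ) x₁ ⊙ ⋯ ⊙ xₙ`: every inversion of `σ`
contributes the product of the parities of the two exchanged elements. -/
def koszulSign {n : ℕ} (d : Fin n → ℤ) (σ : Equiv.Perm (Fin n)) : ℤ :=
  ∏ a : Fin n, ∏ b : Fin n,
    if a < b ∧ σ b < σ a then ((Int.negOnePow (d (σ a) * d (σ b)) : ℤˣ) : ℤ) else 1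

/-- The `(i, n - i)`-shuffles: permutations that are increasing on the first `i` indices and
increasing on the remaining ones. -/
def shuffles (n i : ℕ) : Finset (Equiv.Perm (Fin n)) :=
  {σ | (∀ a b : Fin n, a < b → (b : ℕ) < i → σ a < σ b) ∧
    (∀ a b : Fin n, i ≤ (a : ℕ) → a < b → σ a < σ b)}

/-- The module `M` is the direct sum of the submodules `𝓔 i`, and only degrees `i ≤ -1` occur. -/
structure IsNegativelyGraded {O M : Type*} [CommRing O] [AddCommGroup M] [Module O M]
    (𝓔 : ℤ → Submodule O M) : Prop where
  isInternal : DirectSum.IsInternal 𝓔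
  eq_bot : ∀ i : ℤ, 0 ≤ i → 𝓔 i = ⊥

/-- The sequence `⋯ → 𝓔₋₃ → 𝓔₋₂ → 𝓔₋₁ → A → 0`, with maps the restrictions of the degree `+1` map
`d` and the map `π`, is an exact complex of `O`-modules. -/
structure IsResolution {O M A : Type*} [CommRing O] [AddCommGroup M] [Module O M]
    [AddCommGroup A] [Module O A] (𝓔 : ℤ → Submodule O M)
    (d : M →ₗ[O] M) (π : 𝓔 (-1) →ₗ[O] A) : Prop where
  map_mem : ∀ (i : ℤ), ∀ x ∈ 𝓔 i, d x ∈ 𝓔 (i + 1)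
  exact : ∀ i : ℤ, i ≤ -2 → ∀ x ∈ 𝓔 i, (d x = 0 ↔ ∃ y ∈ 𝓔 (i - 1), d y = x)
  exact_hook : ∀ x : 𝓔 (-1), π x = 0 ↔ ∃ y ∈ 𝓔 (-2), d y = (x : M)
  surjective : Function.Surjective π

/-- A resolution of `A` by free `O`-modules, placed in degrees `≤ -1`. -/
structure IsFreeResolution {O M A : Type*} [CommRing O] [AddCommGroup M] [Module O M]
    [AddCommGroup A] [Module O A] (𝓔 : ℤ → Submodule O M)
    (d : M →ₗ[O] M) (π : 𝓔 (-1) →ₗ[O] A) : Prop extends IsResolution 𝓔 d π where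
  graded : IsNegativelyGraded 𝓔
  free : ∀ i : ℤ, Module.Free O (𝓔 i)

/-- A Lie algebroid structure on a given `O`-module `N`: a Lie-Rinehart algebra structure on `N`,
where `N` is projective. It is data on an existing module (rather than the type classes of
`LieRinehartAlgebra`), so that it can be put on a graded piece `𝓔 (-1)` without introducing a
second additive group structure. -/
structure LieAlgebroidStructure (K O N : Type*) [CommRing K] [CommRing O] [Algebra K O]
    [AddCommGroup N] [Module K N] [Module O N] where
  projective : Module.Projective O N
  /-- the Lie bracket -/
  bracket : N →ₗ[K] N →ₗ[K] N
  /-- the anchor map -/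
  anchor : N →ₗ[O] Derivation K O O
  bracket_self : ∀ x : N, bracket x x = 0
  jacobi : ∀ x y z : N,
    bracket x (bracket y z) + bracket y (bracket z x) + bracket z (bracket x y) = 0
  anchor_bracket : ∀ x y : N, anchor (bracket x y) = ⁅anchor x, anchor y⁆
  leibniz : ∀ (x y : N) (f : O), bracket x (f • y) = anchor x f • y + f • bracket x y

/-- The `O`-linear map `π` from a Lie algebroid to a Lie-Rinehart algebra is a Lie-Rinehart algebra
morphism over `O`: it preserves the brackets and the anchors. -/
structure LieAlgebroidStructure.IsMorphism {K O N A : Type*} [CommRing K] [CommRing O]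
    [Algebra K O] [AddCommGroup N] [Module K N] [Module O N]
    [LieRing A] [LieAlgebra K A] [Module O A] [LieRingModule A O] [LieRinehartRing O A]
    [LieRinehartAlgebra K O A] (S : LieAlgebroidStructure K O N) (π : N →ₗ[O] A) : Prop where
  map_bracket : ∀ x y : N, π (S.bracket x y) = ⁅π x, π y⁆
  map_anchor : ∀ x : N, LieRinehartAlgebra.anchor K O A (π x) = S.anchor x

/-- A (negatively graded) Lie `∞`-algebroid structure on the graded `O`-module with pieces `𝓔 i`,
`i ≤ -1`. The `k`-ary bracket is a graded symmetric `K`-multilinear map of degree `+1`; the value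
at `k = 0` carries no information, since `bracket_mem` forces it into `𝓔 1 = 0`.
The anchor is a map on `𝓔 (-1)`, extended by zero to the other degrees. -/
structure LieInftyAlgebroid (K : Type*) {O M : Type*} [CommRing K] [CommRing O] [Algebra K O]
    [AddCommGroup M] [Module K M] [Module O M] (𝓔 : ℤ → Submodule O M) where
  graded : IsNegativelyGraded 𝓔
  projective : ∀ i : ℤ, Module.Projective O (𝓔 i)
  /-- the brackets `ℓ_k` -/
  bracket : ∀ k : ℕ, MultilinearMap K (fun _ : Fin k => M) M
  /-- the anchor map, extended by zero -/
  anchor : M →ₗ[O] Derivation K O O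
  anchor_eq_zero : ∀ i : ℤ, i ≠ -1 → ∀ x ∈ 𝓔 i, anchor x = 0
  /-- brackets have degree `+1` -/
  bracket_mem : ∀ (k : ℕ) (d : Fin k → ℤ) (x : Fin k → M), (∀ a, x a ∈ 𝓔 (d a)) →
    bracket k x ∈ 𝓔 ((∑ a, d a) + 1)
  /-- brackets are graded symmetric -/
  bracket_perm : ∀ (k : ℕ) (d : Fin k → ℤ) (x : Fin k → M), (∀ a, x a ∈ 𝓔 (d a)) →
    ∀ σ : Equiv.Perm (Fin k), bracket k (fun a => x (σ a)) = koszulSign d σ • bracket k x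
  /-- the higher Jacobi identities; the index `i` stands for the inner bracket of arity `i + 1` -/
  jacobi : ∀ (n : ℕ) (d : Fin n → ℤ) (x : Fin n → M), (∀ a, x a ∈ 𝓔 (d a)) →
    ∑ i : Fin n, ∑ σ ∈ shuffles n (i + 1), koszulSign d σ •
      bracket (n - (i + 1) + 1)
        (Fin.cons (bracket (i + 1) (fun a : Fin (i + 1) => x (σ (a.castLE i.isLt))))
          (fun b : Fin (n - (i + 1)) => x (σ ⟨i + 1 + b, by omega⟩))) = 0
  /-- brackets of arity different from `2` are `O`-multilinear -/
  bracket_smul : ∀ k : ℕ, k ≠ 2 → ∀ (x : Fin k → M) (a : Fin k) (f : O) (y : M),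
    bracket k (Function.update x a (f • y)) = f • bracket k (Function.update x a y)
  leibniz : ∀ (x y : M) (f : O),
    bracket 2 ![x, f • y] = anchor x f • y + f • bracket 2 ![x, y]
  anchor_unary : ∀ x ∈ 𝓔 (-2), anchor (bracket 1 ![x]) = 0
  anchor_bracket : ∀ x ∈ 𝓔 (-1), ∀ y ∈ 𝓔 (-1),
    anchor (bracket 2 ![x, y]) = ⁅anchor x, anchor y⁆

namespace LieInftyAlgebroid

variable {K O M : Type*} [CommRing K] [CommRing O] [Algebra K O]
  [AddCommGroup M] [Module K M] [Module O M] {𝓔 : ℤ → Submodule O M}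

/-- The unary bracket `ℓ₁` as an `O`-linear map. -/
def unary (L : LieInftyAlgebroid K 𝓔) : M →ₗ[O] M where
  toFun x := L.bracket 1 ![x]
  map_add' x y := by
    have h (z : M) : ![z] = Function.update (![0] : Fin 1 → M) 0 z := by
      ext a; fin_cases a; simp
    rw [h x, h y, h (x + y)]
    exact (L.bracket 1).map_update_add ![0] 0 x y
  map_smul' f x := by
    have h (z : M) : ![z] = Function.update (![0] : Fin 1 → M) 0 z := by
      ext a; fin_cases a; simp
    rw [h x, h (f • x)]
    exact L.bracket_smul 1 (by norm_num) ![0] 0 f x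

/-- The restriction of the binary bracket `ℓ₂` to `𝓔 (-1)`. -/
def binary (L : LieInftyAlgebroid K 𝓔) (x y : 𝓔 (-1)) : 𝓔 (-1) :=
  ⟨L.bracket 2 ![(x : M), (y : M)], by
    have h := L.bracket_mem 2 ![-1, -1] ![(x : M), (y : M)]
      (by intro a; fin_cases a <;> simp)
    simpa using h⟩

variable {A : Type*} [LieRing A] [LieAlgebra K A] [Module O A] [LieRingModule A O]
  [LieRinehartRing O A] [LieRinehartAlgebra K O A]

/-- The Lie `∞`-algebroid terminates at the Lie-Rinehart algebra `A` through the hook `π`. -/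
structure TerminatesAt (L : LieInftyAlgebroid K 𝓔) (π : 𝓔 (-1) →ₗ[O] A) : Prop where
  hook_anchor : ∀ x : 𝓔 (-1), LieRinehartAlgebra.anchor K O A (π x) = L.anchor (x : M)
  hook_bracket : ∀ x y : 𝓔 (-1), ⁅π x, π y⁆ = π (L.binary x y)

/-- The Lie `∞`-algebroid is universal for the Lie-Rinehart algebra `A` through the hook `π`: it
terminates at `A`, and its underlying complex (whose terms are projective by definition) is a
resolution of `A`. -/
structure IsUniversal (L : LieInftyAlgebroid K 𝓔) (π : 𝓔 (-1) →ₗ[O] A) : Prop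
    extends L.TerminatesAt π where
  resolution : IsResolution 𝓔 L.unary π

end LieInftyAlgebroid

/-!
The brackets are constructed as families of operations on words of elements of `M` annotated with
degrees (`Family`). A word is a list, so that everything is defined and proved by recursion on its
first letter: `Family.comp e q r` is the signed sum of all ways of inserting an operation `r` of
degree `e` into `q`, and freezing the first argument (`Family.part`) acts on compositions as a
graded derivation. Identities between compositions thereby reduce, by induction on the word, to
their value on the empty word. For a symmetric family `q` of degree `1`, the Jacobiator is
`q.comp 1 q`, and three facts about it carry the argument.

* Compositions satisfy the graded pre-Lie identity (`Family.comp_preLie`), whence the Bianchi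
  identity (`Family.comp_comp_self`): the Jacobiator commutes with `q`.
* The graded commutator of families which are first order differential operators in their last
  argument is again of first order, and its symbol is computed from the symbols of the two families
  (`HasSymbol.commutator`). If the anchor is a morphism killing boundaries, the symbol of the
  Jacobiator vanishes, so the Jacobiator is `O`-multilinear although the binary bracket is not
  (`IsPrebracket.square_smul`).
* On words of letters of degree `-1` the Jacobiator vanishes as soon as the brackets of arity at
  least three do, by the Jacobi identity of the given bracket (`IsPrebracket.square_unit_word`).

Start with the differential, the given bracket in degree `-1` and the flat connection of a basis
(`initialBracket`), and make the Jacobiator vanish on words of total degree `-1`, `-2`, … in turn,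
for all arities at once. If it vanishes above total degree `D`, then by the Bianchi identity its
values in degree `D` are cycles of the resolution, hence boundaries, the only case to be treated by
hand being `D = -3`, where the value lies in degree `-1` and is a boundary because the boundaries
form an ideal there (`IsPrebracket.square_boundary`). As the Jacobiator is `O`-multilinear and the
resolution is free, preimages can be chosen on basis words, extended `O`-multilinearly, and
symmetrized (`exists_primitive`); here characteristic zero is used. Subtracting the result kills the
Jacobiator in degree `D` and changes nothing above (`IsPrebracket.exists_correction`), nor on words
of letters of degree `-1`. The successive approximations therefore have a degreewise limit.

Finally the vanishing of `q.comp 1 q` is rewritten as the sum over shuffles in the higher Jacobi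
identities (`Family.IsSymm.comp_self_ofFn`), and families are turned into multilinear maps by
decomposing all arguments into homogeneous components (`exists_multilinearMap`).
-/


/-! ### Koszul signs and words of annotated elements -/

/-- The sign `(-1) ^ (a * b)` of exchanging homogeneous elements of degrees `a` and `b`. -/
def swapSign (a b : ℤ) : ℤ := ((Int.negOnePow (a * b) : ℤˣ) : ℤ)

theorem swapSign_comm (a b : ℤ) : swapSign a b = swapSign b a := by
  rw [swapSign, swapSign, mul_comm]

theorem swapSign_add_right (a b c : ℤ) :
    swapSign a (b + c) = swapSign a b * swapSign a c := by
  simp [swapSign, mul_add, Int.negOnePow_add]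

theorem swapSign_add_left (a b c : ℤ) :
    swapSign (a + b) c = swapSign a c * swapSign b c := by
  simp [swapSign, add_mul, Int.negOnePow_add]

@[simp] theorem swapSign_zero_left (a : ℤ) : swapSign 0 a = 1 := by simp [swapSign]

@[simp] theorem swapSign_zero_right (a : ℤ) : swapSign a 0 = 1 := by simp [swapSign]

theorem swapSign_eq_one_or (a b : ℤ) : swapSign a b = 1 ∨ swapSign a b = -1 := by
  rcases Int.units_eq_one_or (Int.negOnePow (a * b)) with h | h <;> simp [swapSign, h]

@[simp] theorem swapSign_mul_self (a b : ℤ) : swapSign a b * swapSign a b = 1 := by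
  rcases swapSign_eq_one_or a b with h | h <;> simp [h]

theorem swapSign_mul_swapSign_comm (a b : ℤ) : swapSign a b * swapSign b a = 1 := by
  rw [swapSign_comm b a, swapSign_mul_self]

section Words

variable {M : Type*}

/-- A family of operations of all arities on `M`, evaluated on words whose letters are elements of
`M` annotated with a degree. The annotation governs the signs; nothing forces the element to be
homogeneous of the annotated degree. -/
abbrev Family (M : Type*) := List (ℤ × M) → M

/-- The total annotated degree of a word. -/
def wordDegree (w : List (ℤ × M)) : ℤ := (w.map Prod.fst).sum

@[simp] theorem wordDegree_nil : wordDegree ([] : List (ℤ × M)) = 0 := rfl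

@[simp] theorem wordDegree_cons (x : ℤ × M) (w : List (ℤ × M)) :
    wordDegree (x :: w) = x.1 + wordDegree w := by simp [wordDegree]

@[simp] theorem wordDegree_append (u v : List (ℤ × M)) :
    wordDegree (u ++ v) = wordDegree u + wordDegree v := by simp [wordDegree]

theorem wordDegree_perm {u v : List (ℤ × M)} (h : u.Perm v) : wordDegree u = wordDegree v :=
  (h.map Prod.fst).sum_eq

namespace Family

/-- The partial derivative of a family: its first argument is frozen to be `x`. -/
def part (x : ℤ × M) (q : Family M) : Family M := fun w => q (x :: w)

@[simp] theorem part_apply (x : ℤ × M) (q : Family M) (w : List (ℤ × M)) :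
    part x q w = q (x :: w) := rfl

end Family

end Words

section Calculus

variable {M : Type*} [AddCommGroup M]

namespace Family

/-- The composition of two families, `r` having degree `e`: the signed sum of
`q (v, r (u))` over all ways of distributing the letters of a word into subwords `u` and `v`. It is
defined by recursion on the word: the first letter goes either into `r` or into `q`. -/
def comp : ℤ → Family M → Family M → Family M
  | e, q, r, [] => q [(e, r [])]
  | e, q, r, x :: w => comp (e + x.1) q (part x r) w + swapSign x.1 e • comp e (part x q) r w

theorem comp_nil (e : ℤ) (q r : Family M) : comp e q r [] = q [(e, r [])] := rfl

theorem comp_cons (e : ℤ) (q r : Family M) (x : ℤ × M) (w : List (ℤ × M)) :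
    comp e q r (x :: w) =
      comp (e + x.1) q (part x r) w + swapSign x.1 e • comp e (part x q) r w := rfl

theorem part_comp (e : ℤ) (q r : Family M) (x : ℤ × M) :
    part x (comp e q r) = comp (e + x.1) q (part x r) + swapSign x.1 e • comp e (part x q) r :=
  rfl

/-- Graded symmetry, expressed by the exchange of adjacent letters. -/
def IsSymm (q : Family M) : Prop :=
  ∀ (u : List (ℤ × M)) (a b : ℤ × M) (v : List (ℤ × M)),
    q (u ++ a :: b :: v) = swapSign a.1 b.1 • q (u ++ b :: a :: v)

/-- Additivity in every argument. -/
def IsAdditive (q : Family M) : Prop :=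
  ∀ (u : List (ℤ × M)) (i : ℤ) (x y : M) (v : List (ℤ × M)),
    q (u ++ (i, x + y) :: v) = q (u ++ (i, x) :: v) + q (u ++ (i, y) :: v)

theorem IsSymm.part {q : Family M} (h : IsSymm q) (x : ℤ × M) : IsSymm (part x q) :=
  fun u a b v => h (x :: u) a b v

theorem IsAdditive.part {q : Family M} (h : IsAdditive q) (x : ℤ × M) : IsAdditive (part x q) :=
  fun u i y z v => h (x :: u) i y z v

theorem IsAdditive.map_zero {q : Family M} (h : IsAdditive q) (u v : List (ℤ × M)) (i : ℤ) :
    q (u ++ (i, 0) :: v) = 0 := by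
  simpa using h u i 0 0 v

theorem IsSymm.move_last {q : Family M} (h : IsSymm q) (u v : List (ℤ × M)) (a : ℤ × M) :
    q (u ++ a :: v) = swapSign a.1 (wordDegree v) • q (u ++ v ++ [a]) := by
  induction v generalizing u with
  | nil => simp
  | cons b v ih =>
    have := ih (u ++ [b])
    simp only [List.append_assoc, List.cons_append, List.nil_append] at this ⊢
    rw [h, this, wordDegree_cons, swapSign_add_right, mul_smul]

theorem IsSymm.move_first {q : Family M} (h : IsSymm q) (u v : List (ℤ × M)) (a : ℤ × M) :
    q (u ++ a :: v) = swapSign (wordDegree u) a.1 • q (a :: (u ++ v)) := by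
  induction u generalizing q with
  | nil => simp
  | cons b u ih =>
    have := ih (h.part b)
    simp only [part_apply] at this
    rw [List.cons_append, this]
    have h2 := h [] b a (u ++ v)
    simp only [List.nil_append] at h2
    rw [h2, wordDegree_cons, swapSign_add_left, mul_comm, mul_smul]
    rfl

/-! ### Calculus of compositions -/

theorem comp_add_left (e : ℤ) (q q' r : Family M) :
    comp e (q + q') r = comp e q r + comp e q' r := by
  funext w
  induction w generalizing e q q' r with
  | nil => rfl
  | cons x w ih =>
    have h : part x (q + q') = part x q + part x q' := rfl
    simp only [comp_cons, h, ih, Pi.add_apply, smul_add]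
    abel

theorem comp_neg_left (e : ℤ) (q r : Family M) : comp e (-q) r = -comp e q r := by
  funext w
  induction w generalizing e q r with
  | nil => rfl
  | cons x w ih =>
    have h : part x (-q) = -part x q := rfl
    simp only [comp_cons, h, ih, Pi.neg_apply, smul_neg]
    abel

theorem comp_sign_left (e a b : ℤ) (q r : Family M) :
    comp e (swapSign a b • q) r = swapSign a b • comp e q r := by
  rcases swapSign_eq_one_or a b with hs | hs <;> simp [hs, comp_neg_left]

theorem comp_zero_left (e : ℤ) (r : Family M) : comp e 0 r = 0 := by
  simpa using comp_add_left e 0 0 r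

theorem comp_add_right (e : ℤ) {q : Family M} (hq : IsAdditive q) (r r' : Family M) :
    comp e q (r + r') = comp e q r + comp e q r' := by
  funext w
  induction w generalizing e q r r' with
  | nil => exact hq [] e _ _ []
  | cons x w ih =>
    have h : part x (r + r') = part x r + part x r' := rfl
    simp only [comp_cons, h, ih _ hq, ih _ (hq.part x), Pi.add_apply, smul_add]
    abel

theorem comp_zero_right (e : ℤ) {q : Family M} (hq : IsAdditive q) : comp e q 0 = 0 := by
  simpa using comp_add_right e hq 0 0

theorem comp_neg_right (e : ℤ) {q : Family M} (hq : IsAdditive q) (r : Family M) :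
    comp e q (-r) = -comp e q r := by
  have := comp_add_right e hq r (-r)
  rw [add_neg_cancel, comp_zero_right e hq] at this
  exact (neg_eq_of_add_eq_zero_right this.symm).symm

theorem comp_sign_right (e a b : ℤ) {q : Family M} (hq : IsAdditive q) (r : Family M) :
    comp e q (swapSign a b • r) = swapSign a b • comp e q r := by
  rcases swapSign_eq_one_or a b with hs | hs <;> simp [hs, comp_neg_right e hq]

/-- A composition only depends on the values `q (v, r (u))` for which `u` and `v` together are a
rearrangement of the given word. -/
theorem comp_congr {e : ℤ} {q q' r r' : Family M} {w : List (ℤ × M)}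
    (h : ∀ u v : List (ℤ × M), (u ++ v).Perm w →
      q (v ++ [(e + wordDegree u, r u)]) = q' (v ++ [(e + wordDegree u, r' u)])) :
    comp e q r w = comp e q' r' w := by
  induction w generalizing e q q' r r' with
  | nil => simpa [comp_nil] using h [] [] (by simp)
  | cons x w ih =>
    rw [comp_cons, comp_cons, ih (q := q) (q' := q') (r' := Family.part x r'),
      ih (q := Family.part x q) (q' := Family.part x q') (r := r) (r' := r')]
    · intro u v huv
      exact h u (x :: v) (List.perm_middle.trans (huv.cons x))
    · intro u v huv
      have := h (x :: u) v (by simpa using huv)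
      simpa [add_assoc] using this

theorem comp_eq_zero {e : ℤ} {q r : Family M} {w : List (ℤ × M)}
    (h : ∀ u v : List (ℤ × M), (u ++ v).Perm w → q (v ++ [(e + wordDegree u, r u)]) = 0) :
    comp e q r w = 0 := by
  rw [comp_congr (q' := 0) (r' := r) h, comp_zero_left]
  rfl

theorem comp_eq_single {e : ℤ} {q r : Family M} {w : List (ℤ × M)}
    (h : ∀ u v : List (ℤ × M), (u ++ v).Perm w → v ≠ [] →
      q (v ++ [(e + wordDegree u, r u)]) = 0) :
    comp e q r w = q [(e + wordDegree w, r w)] := by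
  induction w generalizing e r with
  | nil => simp [comp_nil]
  | cons x w ih =>
    rw [comp_cons, ih, comp_eq_zero (q := Family.part x q), smul_zero, add_zero]
    · simp [add_assoc]
    · intro u v huv
      exact h u (x :: v) (List.perm_middle.trans (huv.cons x)) (by simp)
    · intro u v huv hv
      have := h (x :: u) v (by simpa using huv) hv
      simpa [add_assoc] using this

theorem IsSymm.part_part {q : Family M} (h : IsSymm q) (a b : ℤ × M) :
    Family.part b (Family.part a q) =
      swapSign a.1 b.1 • Family.part a (Family.part b q) :=
  funext fun v => h [] a b v

theorem IsSymm.comp {q r : Family M} (hq : IsSymm q) (hr : IsSymm r) (ha : IsAdditive q)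
    (e : ℤ) : IsSymm (comp e q r) := by
  intro u a b v
  induction u generalizing e q r with
  | nil =>
    simp only [List.nil_append, comp_cons, hq.part_part a b, hr.part_part a b, comp_sign_left,
      comp_sign_right _ _ _ ha, Pi.smul_apply, swapSign_add_right, add_assoc, add_comm b.1 a.1]
    rw [swapSign_comm b.1 a.1]
    rcases swapSign_eq_one_or a.1 b.1 with h1 | h1 <;>
    rcases swapSign_eq_one_or a.1 e with h2 | h2 <;>
    rcases swapSign_eq_one_or b.1 e with h3 | h3 <;> simp [h1, h2, h3] <;> abel
  | cons x u ih =>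
    simp only [List.cons_append, comp_cons]
    rw [ih hq (hr.part x) ha, ih (hq.part x) hr (ha.part x), smul_add, smul_comm]

/-- The pre-Lie identity: the associator of three families is graded symmetric in its last two
arguments. -/
theorem comp_preLie (w : List (ℤ × M)) {q r s : Family M} (b c : ℤ)
    (hq : IsSymm q) (ha : IsAdditive q) (hr : IsAdditive r) (hs : IsAdditive s) :
    comp c (comp b q r) s w - comp (b + c) q (comp c r s) w =
      swapSign b c • (comp b (comp c q s) r w - comp (b + c) q (comp b s r) w) := by
  induction w generalizing q r s b c with
  | nil =>
    have h := hq [] (c, s []) (b, r []) []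
    simp only [List.nil_append] at h
    -- On the empty word the associator is `q` applied to the two values `r []` and `s []`.
    simp only [comp_nil, comp_cons, part_apply, h]
    rw [add_comm c b, swapSign_comm c b]
    rcases swapSign_eq_one_or b c with h1 | h1 <;> simp [h1]
  | cons x w ih =>
    -- Freezing a letter acts as a derivation on associators, so the three cases in which it goes
    -- to `s`, `r` or `q` are instances of the induction hypothesis.
    have e1 := ih b (c + x.1) hq ha hr (hs.part x)
    have e2 := ih (b + x.1) c hq ha (hr.part x) hs
    have e3 := ih b c (hq.part x) (ha.part x) hr hs
    simp only [comp_cons, part_comp, comp_add_left, comp_sign_left, comp_add_right _ ha,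
      comp_sign_right _ _ _ ha, Pi.add_apply, Pi.smul_apply]
    have a1 : b + x.1 + c = b + c + x.1 := by ring
    have a2 : b + (c + x.1) = b + c + x.1 := by ring
    rw [a1] at e2
    rw [a2] at e1
    simp only [swapSign_add_right, swapSign_add_left] at e1 e2 e3 ⊢
    rw [swapSign_comm b x.1] at e1
    rcases swapSign_eq_one_or b c with h1 | h1 <;>
    rcases swapSign_eq_one_or x.1 b with h2 | h2 <;>
    rcases swapSign_eq_one_or x.1 c with h3 | h3 <;>
    simp only [h1, h2, h3, one_smul, neg_smul, mul_one, mul_neg, neg_neg] at e1 e2 e3 ⊢ <;>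
    · rw [sub_eq_iff_eq_add] at e1 e2 e3
      rw [e1, e2, e3]
      abel

/-- The Bianchi identity for an odd family `q`: it commutes with its square. -/
theorem comp_comp_self [IsAddTorsionFree M] {q : Family M} (hq : IsSymm q) (ha : IsAdditive q)
    (w : List (ℤ × M)) : comp 1 (comp 1 q q) q w = comp 2 q (comp 1 q q) w := by
  have h := comp_preLie w 1 1 hq ha ha ha
  have hs : swapSign 1 1 = -1 := by decide
  rw [hs, neg_smul, one_smul] at h
  exact sub_eq_zero.mp (self_eq_neg.mp h)

end Family

end Calculus

/-! ### Homogeneous symmetric families and their symbols -/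

section SymbolBracket

variable {K O M : Type*} [CommRing K] [CommRing O] [Algebra K O]

/-- The symbol of the graded commutator of two families of degrees `a` and `b` with symbols `σ` and
`τ`, by recursion on the word: freezing a letter is a graded derivation of the commutator, and on
the empty word the symbols commute as differential operators while each family is evaluated on the
value of the other. -/
def symbolBracket : ℤ → ℤ → Family M → Family M → (List (ℤ × M) → Derivation K O O) →
    (List (ℤ × M) → Derivation K O O) → List (ℤ × M) → Derivation K O O
  | a, b, q, r, σ, τ, [] => ⁅σ [], τ []⁆ + σ [(b, r [])] - swapSign a b • τ [(a, q [])]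
  | a, b, q, r, σ, τ, x :: w =>
    symbolBracket a (b + x.1) q (r.part x) σ (fun u => τ (x :: u)) w +
      swapSign x.1 b • symbolBracket (a + x.1) b (q.part x) r (fun u => σ (x :: u)) τ w

/-- The symbol of a graded commutator lives in total degree zero. -/
theorem symbolBracket_eq_zero {a b : ℤ} {q r : Family M}
    {σ τ : List (ℤ × M) → Derivation K O O} (hσ0 : ∀ u, a + wordDegree u ≠ 0 → σ u = 0)
    (hτ0 : ∀ u, b + wordDegree u ≠ 0 → τ u = 0) (w : List (ℤ × M))
    (hw : a + b + wordDegree w ≠ 0) : symbolBracket a b q r σ τ w = 0 := by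
  induction w generalizing a b q r σ τ with
  | nil =>
    rw [wordDegree_nil, add_zero] at hw
    have h1 : ⁅σ [], τ []⁆ = 0 := by
      by_cases ha : a = 0
      · rw [hτ0 [] (by simp; omega), lie_zero]
      · rw [hσ0 [] (by simpa using ha), zero_lie]
    rw [symbolBracket, h1, hσ0 _ (by simpa using hw), hτ0 _ (by simp; omega)]
    simp
  | cons x w ih =>
    rw [wordDegree_cons] at hw
    rw [symbolBracket, ih hσ0 (fun u hu => hτ0 (x :: u) (by simpa [add_assoc] using hu)),
      ih (fun u hu => hσ0 (x :: u) (by simpa [add_assoc] using hu)) hτ0]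
    · simp
    · omega
    · omega

end SymbolBracket

section Graded

variable {O M : Type*} [CommRing O] [AddCommGroup M] [Module O M]

/-- The maps `p i` are the projections onto the pieces of the grading `𝓔`. -/
structure IsGradedProjection (𝓔 : ℤ → Submodule O M) (p : ℤ → M →ₗ[O] M) : Prop where
  mem : ∀ i x, p i x ∈ 𝓔 i
  of_mem : ∀ i, ∀ x ∈ 𝓔 i, p i x = x
  of_mem_ne : ∀ i j, j ≠ i → ∀ x ∈ 𝓔 i, p j x = 0
  finite : ∀ x, {i | p i x ≠ 0}.Finite
  sum : ∀ (x : M) (t : Finset ℤ), (∀ i, p i x ≠ 0 → i ∈ t) → ∑ i ∈ t, p i x = x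

theorem DirectSum.IsInternal.exists_isGradedProjection {𝓔 : ℤ → Submodule O M}
    (h : DirectSum.IsInternal 𝓔) : ∃ p : ℤ → M →ₗ[O] M, IsGradedProjection 𝓔 p := by
  classical
  let E : (DirectSum ℤ fun i => 𝓔 i) ≃ₗ[O] M :=
    LinearEquiv.ofBijective (DirectSum.coeLinearMap 𝓔) h
  have hE (z) : E z = DirectSum.coeLinearMap 𝓔 z := rfl
  have key (i : ℤ) (x : M) (hx : x ∈ 𝓔 i) :
      E.symm x = DirectSum.lof O ℤ (fun i => 𝓔 i) i ⟨x, hx⟩ := by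
    rw [LinearEquiv.symm_apply_eq, hE, DirectSum.coeLinearMap_lof]
  refine ⟨fun i => (𝓔 i).subtype ∘ₗ DirectSum.component O ℤ _ i ∘ₗ E.symm.toLinearMap,
    fun i x => by simp, fun i x hx => ?_, fun i j hij x hx => ?_, fun x => ?_, fun x t ht => ?_⟩
  · simp [key i x hx, DirectSum.component.lof_self]
  · simp [key i x hx, DirectSum.component.of, Ne.symm hij]
  · refine (DFinsupp.support (E.symm x)).finite_toSet.subset fun i hi => ?_
    simp only [Finset.mem_coe, DFinsupp.mem_support_toFun]
    intro h0
    apply hi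
    have : DirectSum.component O ℤ (fun i => 𝓔 i) i (E.symm x) = 0 := h0
    simp [this]
  · conv_rhs => rw [← E.apply_symm_apply x, hE, DirectSum.coeLinearMap_eq_dfinsuppSum,
      DFinsupp.sum]
    symm
    apply Finset.sum_subset
    · intro i hi
      apply ht
      simp only [DFinsupp.mem_support_toFun] at hi
      intro h0
      exact hi (Subtype.ext h0)
    · intro i _ hi
      simp only [DFinsupp.mem_support_toFun, not_not] at hi
      rw [hi]; rfl

/-- A graded symmetric family of multiadditive brackets of degree `e`, which only sees the
homogeneous component of each argument in its annotated degree. -/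
structure IsBracketFamily (p : ℤ → M →ₗ[O] M) (e : ℤ) (q : Family M) : Prop where
  symm : q.IsSymm
  add : q.IsAdditive
  homog : ∀ w, p (e + wordDegree w) (q w) = q w
  proj : ∀ (u : List (ℤ × M)) (i : ℤ) (x : M) (v : List (ℤ × M)),
    p i x = 0 → q (u ++ (i, x) :: v) = 0

namespace IsBracketFamily

variable {𝓔 : ℤ → Submodule O M} {p : ℤ → M →ₗ[O] M} {a b : ℤ} {q r : Family M}

theorem part (hq : IsBracketFamily p a q) (x : ℤ × M) :
    IsBracketFamily p (a + x.1) (q.part x) where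
  symm := hq.symm.part x
  add := hq.add.part x
  homog w := by simpa [add_assoc] using hq.homog (x :: w)
  proj u i y v h := hq.proj (x :: u) i y v h

theorem map_proj (hp : IsGradedProjection 𝓔 p) (hq : IsBracketFamily p a q)
    (u : List (ℤ × M)) (i : ℤ) (x : M) (v : List (ℤ × M)) :
    q (u ++ (i, p i x) :: v) = q (u ++ (i, x) :: v) := by
  have h := hq.add u i (x - p i x) (p i x) v
  rw [sub_add_cancel, hq.proj u i (x - p i x) v, zero_add] at h
  · exact h.symm
  · rw [map_sub, hp.of_mem i _ (hp.mem i x), sub_self]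

theorem mem (hp : IsGradedProjection 𝓔 p) (hq : IsBracketFamily p a q) (w : List (ℤ × M)) :
    q w ∈ 𝓔 (a + wordDegree w) := by
  rw [← hq.homog w]; exact hp.mem _ _

/-- It suffices to check additivity and locality in the first argument. -/
theorem of_first (hs : q.IsSymm)
    (hadd : ∀ i x y v, q ((i, x + y) :: v) = q ((i, x) :: v) + q ((i, y) :: v))
    (hhom : ∀ w, p (a + wordDegree w) (q w) = q w)
    (hproj : ∀ i x v, p i x = 0 → q ((i, x) :: v) = 0) : IsBracketFamily p a q where
  symm := hs
  add u i x y v := by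
    rw [hs.move_first, hs.move_first u v (i, x), hs.move_first u v (i, y), hadd, smul_add]
  homog := hhom
  proj u i x v h := by rw [hs.move_first, hproj _ _ _ h, smul_zero]

theorem comp (hq : IsBracketFamily p a q) (hr : IsBracketFamily p b r) :
    IsBracketFamily p (a + b) (q.comp b r) := by
  refine of_first (hq.symm.comp hr.symm hq.add b) ?_ ?_ ?_
  · intro i x y v
    have h1 : q.part (i, x + y) = q.part (i, x) + q.part (i, y) :=
      funext fun v => hq.add [] i x y v
    have h2 : r.part (i, x + y) = r.part (i, x) + r.part (i, y) :=
      funext fun v => hr.add [] i x y v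
    simp only [Family.comp_cons, h1, h2, Family.comp_add_left, Family.comp_add_right _ hq.add,
      Pi.add_apply, smul_add]
    abel
  · intro w
    induction w generalizing a b q r with
    | nil => simpa [Family.comp_nil] using hq.homog [(b, r [])]
    | cons x w ih =>
      have e1 := ih hq (hr.part x)
      have e2 := ih (hq.part x) hr
      rw [Family.comp_cons, map_add, map_zsmul, wordDegree_cons]
      have a1 : a + b + (x.1 + wordDegree w) = a + (b + x.1) + wordDegree w := by ring
      have a2 : a + b + (x.1 + wordDegree w) = a + x.1 + b + wordDegree w := by ring
      congr 1
      · rw [a1, e1]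
      · rw [a2, e2]
  · intro i x v h
    have h1 : q.part (i, x) = 0 := funext fun v => hq.proj [] i x v h
    have h2 : r.part (i, x) = 0 := funext fun v => hr.proj [] i x v h
    rw [Family.comp_cons, h1, h2, Family.comp_zero_left, Family.comp_zero_right _ hq.add]
    simp

theorem addFamily (hq : IsBracketFamily p a q) (hr : IsBracketFamily p a r) :
    IsBracketFamily p a (q + r) where
  symm u x y v := by simp [hq.symm u x y v, hr.symm u x y v]
  add u i x y v := by simp only [Pi.add_apply, hq.add u i x y v, hr.add u i x y v]; abel
  homog w := by simp [hq.homog w, hr.homog w]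
  proj u i x v h := by simp [hq.proj u i x v h, hr.proj u i x v h]

end IsBracketFamily

/-- The family `q` is a first order differential operator in its last argument, with symbol `σ`
taking values in the derivations of `O`. -/
def HasSymbol {K : Type*} [CommRing K] [Algebra K O] (p : ℤ → M →ₗ[O] M) (q : Family M)
    (σ : List (ℤ × M) → Derivation K O O) : Prop :=
  ∀ (u : List (ℤ × M)) (i : ℤ) (f : O) (y : M),
    q (u ++ [(i, f • y)]) = f • q (u ++ [(i, y)]) + σ u f • p i y

section Symbol

variable {K : Type*} [CommRing K] [Algebra K O] {𝓔 : ℤ → Submodule O M} {p : ℤ → M →ₗ[O] M}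
  {a b : ℤ} {q r : Family M} {σ τ : List (ℤ × M) → Derivation K O O}

theorem HasSymbol.part (h : HasSymbol p q σ) (x : ℤ × M) :
    HasSymbol p (q.part x) (fun u => σ (x :: u)) :=
  fun u i f y => h (x :: u) i f y

/-- In the graded commutator of two families the second order terms cancel, so that it is again of
first order in its last argument. -/
theorem HasSymbol.commutator (hp : IsGradedProjection 𝓔 p) (hq : IsBracketFamily p a q)
    (hr : IsBracketFamily p b r) (hσ : HasSymbol p q σ) (hτ : HasSymbol p r τ)
    (hσ0 : ∀ u, a + wordDegree u ≠ 0 → σ u = 0) (hτ0 : ∀ u, b + wordDegree u ≠ 0 → τ u = 0)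
    (w : List (ℤ × M)) (i : ℤ) (f : O) (y : M) :
    q.comp b r (w ++ [(i, f • y)]) - swapSign a b • r.comp a q (w ++ [(i, f • y)]) =
      f • (q.comp b r (w ++ [(i, y)]) - swapSign a b • r.comp a q (w ++ [(i, y)])) +
        symbolBracket a b q r σ τ w f • p i y := by
  induction w generalizing a b q r σ τ with
  | nil =>
    have pp (y : M) : p i (p i y) = p i y := hp.of_mem i _ (hp.mem i y)
    have q1 (z : M) : q [(i, f • y), (b, z)] = swapSign i b • q [(b, z), (i, f • y)] :=
      hq.symm [] (i, f • y) (b, z) []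
    have q2 (z : M) : q [(i, y), (b, z)] = swapSign i b • q [(b, z), (i, y)] :=
      hq.symm [] (i, y) (b, z) []
    have r1 (z : M) : r [(i, f • y), (a, z)] = swapSign i a • r [(a, z), (i, f • y)] :=
      hr.symm [] (i, f • y) (a, z) []
    have r2 (z : M) : r [(i, y), (a, z)] = swapSign i a • r [(a, z), (i, y)] :=
      hr.symm [] (i, y) (a, z) []
    have q3 (z : M) : q [(b, z), (i, f • y)] = f • q [(b, z), (i, y)] + σ [(b, z)] f • p i y :=
      hσ [(b, z)] i f y
    have r3 (z : M) : r [(a, z), (i, f • y)] = f • r [(a, z), (i, y)] + τ [(a, z)] f • p i y :=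
      hτ [(a, z)] i f y
    have q4 (j : ℤ) (g : O) (z : M) : q [(j, g • z)] = g • q [(j, z)] + σ [] g • p j z :=
      hσ [] j g z
    have r4 (j : ℤ) (g : O) (z : M) : r [(j, g • z)] = g • r [(j, z)] + τ [] g • p j z :=
      hτ [] j g z
    have q5 (j : ℤ) (z z' : M) : q [(j, z + z')] = q [(j, z)] + q [(j, z')] :=
      hq.add [] j z z' []
    have r5 (j : ℤ) (z z' : M) : r [(j, z + z')] = r [(j, z)] + r [(j, z')] :=
      hr.add [] j z z' []
    have q6 : q [(i, p i y)] = q [(i, y)] := hq.map_proj hp [] i y []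
    have r6 : r [(i, p i y)] = r [(i, y)] := hr.map_proj hp [] i y []
    have q7 : p (a + i) (q [(i, y)]) = q [(i, y)] := by simpa using hq.homog [(i, y)]
    have r7 : p (b + i) (r [(i, y)]) = r [(i, y)] := by simpa using hr.homog [(i, y)]
    simp only [List.nil_append, Family.comp_cons, Family.comp_nil, Family.part_apply,
      symbolBracket, q1, q2, r1, r2, q3, r3, q4, r4, q5, r5, q7, r7, smul_add, smul_smul,
      swapSign_mul_self, Derivation.add_apply, Derivation.sub_apply,
      Derivation.smul_apply, Derivation.commutator_apply]
    -- The symbol `σ []` vanishes unless `a = 0`, and `τ []` unless `b = 0`. In these cases the sign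
    -- of the commutator is `1`, so that the mixed terms `σ [] f • r [y]` and `τ [] f • q [y]` cancel.
    by_cases ha : a = 0
    · by_cases hb : b = 0
      · subst ha hb
        simp only [zero_add, q6, r6, pp, swapSign_zero_right, one_smul, mul_one, sub_smul,
          add_smul, smul_sub, smul_add]
        abel
      · subst ha
        have h0 : τ [] = 0 := hτ0 [] (by simpa using hb)
        simp only [h0, zero_add, r6, pp, swapSign_zero_left, one_smul,
          mul_one, sub_smul, add_smul, smul_sub, smul_add, Derivation.zero_apply,
          zero_smul, map_zero]
        abel
    · have h0 : σ [] = 0 := hσ0 [] (by simpa using ha)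
      by_cases hb : b = 0
      · subst hb
        simp only [h0, zero_add, q6, pp, swapSign_zero_right,
          one_smul, mul_one, sub_smul, add_smul, smul_sub, smul_add,
          Derivation.zero_apply, zero_smul, map_zero]
        abel
      · have h1 : τ [] = 0 := hτ0 [] (by simpa using hb)
        simp only [h0, h1, sub_smul, add_smul, smul_sub, smul_add,
          Derivation.zero_apply, zero_smul, map_zero]
        rcases swapSign_eq_one_or a b with hs | hs <;> simp [hs] <;> abel
  | cons x w ih =>
    have e1 := ih hq (hr.part x) hσ (hτ.part x) hσ0
      (fun u hu => hτ0 (x :: u) (by simpa [add_assoc] using hu))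
    have e2 := ih (hq.part x) hr (hσ.part x) hτ
      (fun u hu => hσ0 (x :: u) (by simpa [add_assoc] using hu)) hτ0
    simp only [List.cons_append, Family.comp_cons, symbolBracket, Derivation.add_apply,
      Derivation.smul_apply, add_smul]
    simp only [swapSign_add_right, swapSign_add_left] at e1 e2
    rw [swapSign_comm a x.1] at e1
    rcases swapSign_eq_one_or a b with h1 | h1 <;>
    rcases swapSign_eq_one_or x.1 b with h2 | h2 <;>
    rcases swapSign_eq_one_or x.1 a with h3 | h3 <;>
    simp only [h1, h2, h3, one_smul, neg_smul, mul_one, mul_neg, neg_neg, smul_add, smul_neg,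
      smul_sub, sub_neg_eq_add] at e1 e2 ⊢ <;>
    first
    | linear_combination (norm := abel1) e1 + e2
    | linear_combination (norm := abel1) e1 - e2

end Symbol

end Graded

/-! ### Symmetrization of families -/

section Symmetrize

variable {M : Type*} [AddCommGroup M]

namespace Family

/-- The signed sum of the values of `h` on the words obtained from a given word by inserting the
letter `x` at any place. -/
def insertLetter (x : ℤ × M) : Family M → Family M
  | h, [] => h [x]
  | h, y :: u => h (x :: y :: u) + swapSign x.1 y.1 • insertLetter x (part y h) u

/-- The sum of the values of `h` on all permutations of a word, with Koszul signs. -/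
def symmetrize : Family M → Family M
  | h, [] => h []
  | h, x :: w => symmetrize (insertLetter x h) w

theorem insertLetter_cons (x : ℤ × M) (h : Family M) (y : ℤ × M) (u : List (ℤ × M)) :
    insertLetter x h (y :: u) =
      h (x :: y :: u) + swapSign x.1 y.1 • insertLetter x (part y h) u := rfl

theorem symmetrize_cons (h : Family M) (x : ℤ × M) (w : List (ℤ × M)) :
    symmetrize h (x :: w) = symmetrize (insertLetter x h) w := rfl

theorem insertLetter_map (g : M →+ M) (x : ℤ × M) (h : Family M) :
    insertLetter x (fun w => g (h w)) = fun w => g (insertLetter x h w) := by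
  funext w
  induction w generalizing h with
  | nil => rfl
  | cons y u ih =>
    have := ih (part y h)
    simp only [insertLetter_cons, map_add, map_zsmul, ← this]
    rfl

theorem symmetrize_map (g : M →+ M) (h : Family M) (w : List (ℤ × M)) :
    symmetrize (fun w => g (h w)) w = g (symmetrize h w) := by
  induction w generalizing h with
  | nil => rfl
  | cons x w ih => rw [symmetrize_cons, insertLetter_map, ih, symmetrize_cons]

theorem insertLetter_add (x : ℤ × M) (h h' : Family M) :
    insertLetter x (h + h') = insertLetter x h + insertLetter x h' := by
  funext w
  induction w generalizing h h' with
  | nil => rfl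
  | cons y u ih =>
    have e : part y (h + h') = part y h + part y h' := rfl
    simp only [insertLetter_cons, e, ih, Pi.add_apply, smul_add]
    abel

theorem symmetrize_add (h h' : Family M) (w : List (ℤ × M)) :
    symmetrize (h + h') w = symmetrize h w + symmetrize h' w := by
  induction w generalizing h h' with
  | nil => rfl
  | cons x w ih => simp only [symmetrize_cons, insertLetter_add, ih]

theorem symmetrize_sign (a b : ℤ) (h : Family M) (w : List (ℤ × M)) :
    symmetrize (swapSign a b • h) w = swapSign a b • symmetrize h w :=
  symmetrize_map (DistribSMul.toAddMonoidHom M (swapSign a b)) h w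

theorem insertLetter_sign (a b : ℤ) (x : ℤ × M) (h : Family M) :
    insertLetter x (swapSign a b • h) = swapSign a b • insertLetter x h :=
  insertLetter_map (DistribSMul.toAddMonoidHom M (swapSign a b)) x h

theorem symmetrize_zero (w : List (ℤ × M)) : symmetrize (0 : Family M) w = 0 := by
  simpa using symmetrize_add 0 0 w

theorem part_insertLetter (x y : ℤ × M) (h : Family M) :
    part y (insertLetter x h) =
      part y (part x h) + swapSign x.1 y.1 • insertLetter x (part y h) := rfl

theorem insertLetter_comm (a b : ℤ × M) (h : Family M) :
    insertLetter b (insertLetter a h) = swapSign a.1 b.1 • insertLetter a (insertLetter b h) := by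
  funext u
  induction u generalizing h with
  | nil =>
    change h [a, b] + swapSign a.1 b.1 • h [b, a] =
      swapSign a.1 b.1 • (h [b, a] + swapSign b.1 a.1 • h [a, b])
    rw [smul_add, smul_smul, swapSign_mul_swapSign_comm, one_smul, add_comm]
  | cons y u ih =>
    simp only [Pi.smul_apply, insertLetter_cons, part_insertLetter, insertLetter_add,
      insertLetter_sign, Pi.add_apply, ih, smul_add, part_apply]
    rw [swapSign_comm b.1 a.1]
    rcases swapSign_eq_one_or a.1 b.1 with h1 | h1 <;>
    rcases swapSign_eq_one_or a.1 y.1 with h2 | h2 <;>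
    rcases swapSign_eq_one_or b.1 y.1 with h3 | h3 <;> simp [h1, h2, h3] <;> abel

theorem isSymm_symmetrize (h : Family M) : IsSymm (symmetrize h) := by
  intro u a b v
  induction u generalizing h with
  | nil =>
    simp only [List.nil_append, symmetrize_cons]
    rw [insertLetter_comm, symmetrize_sign]
  | cons x u ih => exact ih (insertLetter x h)

theorem insertLetter_congr {x : ℤ × M} {h h' : Family M} {w : List (ℤ × M)}
    (e : ∀ u : List (ℤ × M), u.Perm (x :: w) → h u = h' u) :
    insertLetter x h w = insertLetter x h' w := by
  induction w generalizing h h' with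
  | nil => exact e [x] (.refl _)
  | cons y w ih =>
    rw [insertLetter_cons, insertLetter_cons, e _ (.refl _), ih]
    exact fun u hu => e (y :: u) ((hu.cons y).trans (.swap x y w))

theorem symmetrize_congr {h h' : Family M} {w : List (ℤ × M)}
    (e : ∀ u : List (ℤ × M), u.Perm w → h u = h' u) : symmetrize h w = symmetrize h' w := by
  induction w generalizing h h' with
  | nil => exact e [] (.refl _)
  | cons x w ih =>
    refine ih fun u hu => insertLetter_congr fun l hl => e l (hl.trans (hu.cons x))

theorem IsSymm.insertLetter {h : Family M} (hh : IsSymm h) (x : ℤ × M) (w : List (ℤ × M)) :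
    insertLetter x h w = (w.length + 1) • h (x :: w) := by
  induction w generalizing h with
  | nil => simp [Family.insertLetter]
  | cons y w ih =>
    have := hh [] x y w
    simp only [List.nil_append] at this
    rw [insertLetter_cons, ih (hh.part y), part_apply, smul_comm, ← this, List.length_cons,
      add_smul (w.length + 1) 1, one_smul, add_comm]

/-- Symmetrization multiplies a symmetric family by the number of permutations. -/
theorem IsSymm.symmetrize {h : Family M} (hh : IsSymm h) (w : List (ℤ × M)) :
    symmetrize h w = w.length.factorial • h w := by
  induction w generalizing h with
  | nil => simp [Family.symmetrize]
  | cons x w ih =>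
    rw [symmetrize_cons, symmetrize_congr (h' := fun u => (w.length + 1) • Family.part x h u)]
    · have := symmetrize_map (DistribSMul.toAddMonoidHom M (w.length + 1)) (Family.part x h) w
      simp only [DistribSMul.toAddMonoidHom_apply] at this
      rw [this, ih (hh.part x), smul_smul, List.length_cons, Nat.factorial_succ, part_apply]
    · intro u hu
      rw [hh.insertLetter, hu.length_eq, part_apply]

end Family

end Symmetrize

/-! ### Operations prescribed on homogeneous bases -/

section Extend

variable {O M : Type*} [CommRing O] [AddCommGroup M] [Module O M]

namespace Family

variable (O) in
/-- Compatibility with multiplication by elements of `O` in every argument. -/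
def MapsSMul (q : Family M) : Prop :=
  ∀ (u : List (ℤ × M)) (i : ℤ) (f : O) (x : M) (v : List (ℤ × M)),
    q (u ++ (i, f • x) :: v) = f • q (u ++ (i, x) :: v)

theorem MapsSMul.part {q : Family M} (h : q.MapsSMul O) (x : ℤ × M) : (q.part x).MapsSMul O :=
  fun u i f y v => h (x :: u) i f y v

theorem IsSymm.mapsSMul_of_first {q : Family M} (hs : q.IsSymm)
    (h : ∀ i (f : O) x v, q ((i, f • x) :: v) = f • q ((i, x) :: v)) : q.MapsSMul O := by
  intro u i f x v
  rw [hs.move_first, hs.move_first u v (i, x), h, smul_comm]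

theorem symmetrize_mapsSMul {h : Family M} (hh : h.MapsSMul O) : (symmetrize h).MapsSMul O := by
  refine (isSymm_symmetrize h).mapsSMul_of_first fun i f x v => ?_
  have e : insertLetter (i, f • x) h = fun w => f • insertLetter (i, x) h w := by
    funext w
    induction w generalizing h with
    | nil => exact hh [] i f x []
    | cons y w ih =>
      rw [insertLetter_cons, insertLetter_cons, ih (hh.part y), smul_add, smul_comm f]
      congr 1
      exact hh [] i f x (y :: w)
  rw [symmetrize_cons, symmetrize_cons, e]
  exact symmetrize_map (DistribSMul.toAddMonoidHom M f) _ v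

theorem symmetrize_first_add {h : Family M} (hh : h.IsAdditive) (i : ℤ) (x y : M)
    (v : List (ℤ × M)) :
    symmetrize h ((i, x + y) :: v) = symmetrize h ((i, x) :: v) + symmetrize h ((i, y) :: v) := by
  have e : insertLetter (i, x + y) h = insertLetter (i, x) h + insertLetter (i, y) h := by
    funext w
    induction w generalizing h with
    | nil => exact hh [] i x y []
    | cons z w ih =>
      have := hh [] i x y (z :: w)
      simp only [List.nil_append] at this
      simp only [insertLetter_cons, ih (hh.part z), smul_add, Pi.add_apply, this]
      abel
  rw [symmetrize_cons, e, symmetrize_add]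
  rfl

theorem symmetrize_first_eq_zero {h : Family M} {i : ℤ} {x : M}
    (hh : ∀ u v, h (u ++ (i, x) :: v) = 0) (v : List (ℤ × M)) :
    symmetrize h ((i, x) :: v) = 0 := by
  have e : insertLetter (i, x) h = 0 := by
    funext w
    induction w generalizing h with
    | nil => exact hh [] []
    | cons z w ih =>
      rw [insertLetter_cons, ih fun u v => hh (z :: u) v]
      simpa using hh [] (z :: w)
  rw [symmetrize_cons, e, symmetrize_zero]

theorem symmetrize_mem {N : AddSubgroup M} {h : Family M} {w : List (ℤ × M)}
    (hh : ∀ u : List (ℤ × M), u.Perm w → h u ∈ N) : symmetrize h w ∈ N := by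
  have key (x : ℤ × M) (h : Family M) (w : List (ℤ × M))
      (hh : ∀ u : List (ℤ × M), u.Perm (x :: w) → h u ∈ N) : insertLetter x h w ∈ N := by
    induction w generalizing h with
    | nil => exact hh _ (.refl _)
    | cons y w ih =>
      exact N.add_mem (hh _ (.refl _)) (N.zsmul_mem (ih _ fun u hu =>
        hh (y :: u) ((hu.cons y).trans (.swap x y w))) _)
  induction w generalizing h with
  | nil => exact hh _ (.refl _)
  | cons x w ih => exact ih fun u hu => key x h u fun l hl => hh l (hl.trans (hu.cons x))

end Family

variable {ι : ℤ → Type*}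

/-- The multilinear extension of a family of values on words of basis letters; `c i x` are the
coordinates of the component of degree `i` of `x`. -/
noncomputable def basisExtend (c : ∀ i, M →ₗ[O] (ι i →₀ O)) :
    (List (Σ i, ι i) → M) → Family M
  | v, [] => v []
  | v, x :: w =>
    Finsupp.linearCombination O (fun b => basisExtend c (fun l => v (⟨x.1, b⟩ :: l)) w) (c x.1 x.2)

variable {c : ∀ i, M →ₗ[O] (ι i →₀ O)}

theorem basisExtend_cons (v : List (Σ i, ι i) → M) (x : ℤ × M) (w : List (ℤ × M)) :
    basisExtend c v (x :: w) = Finsupp.linearCombination O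
      (fun b => basisExtend c (fun l => v (⟨x.1, b⟩ :: l)) w) (c x.1 x.2) := rfl

theorem basisExtend_isAdditive (v : List (Σ i, ι i) → M) : (basisExtend c v).IsAdditive := by
  intro u i x y w
  induction u generalizing v with
  | nil => simp only [List.nil_append, basisExtend_cons, map_add]
  | cons z u ih =>
    simp only [List.cons_append, basisExtend_cons, ih, Finsupp.linearCombination_apply,
      Finsupp.sum, smul_add, Finset.sum_add_distrib]

theorem basisExtend_mapsSMul (v : List (Σ i, ι i) → M) : (basisExtend c v).MapsSMul O := by
  intro u i f x w
  induction u generalizing v with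
  | nil => simp only [List.nil_append, basisExtend_cons, map_smul]
  | cons z u ih =>
    simp only [List.cons_append, basisExtend_cons, ih, Finsupp.linearCombination_apply,
      Finsupp.sum, Finset.smul_sum, smul_comm f]

theorem basisExtend_eq_zero (v : List (Σ i, ι i) → M) {i : ℤ} {x : M} (hx : c i x = 0)
    (u w : List (ℤ × M)) : basisExtend c v (u ++ (i, x) :: w) = 0 := by
  induction u generalizing v with
  | nil => simp only [List.nil_append, basisExtend_cons, hx, map_zero]
  | cons z u ih =>
    simp only [List.cons_append, basisExtend_cons, ih, Finsupp.linearCombination_apply,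
      Finsupp.sum, smul_zero, Finset.sum_const_zero]

theorem basisExtend_mem {N : Submodule O M} {v : List (Σ i, ι i) → M} {w : List (ℤ × M)}
    (h : ∀ l, v l ∈ N) : basisExtend c v w ∈ N := by
  induction w generalizing v with
  | nil => exact h []
  | cons x w ih =>
    rw [basisExtend_cons, Finsupp.linearCombination_apply]
    exact N.sum_mem fun b _ => N.smul_mem _ (ih fun l => h _)

theorem map_basisExtend (g : M →ₗ[O] M) (v : List (Σ i, ι i) → M) (w : List (ℤ × M)) :
    g (basisExtend c v w) = basisExtend c (fun l => g (v l)) w := by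
  induction w generalizing v with
  | nil => rfl
  | cons x w ih =>
    simp only [basisExtend_cons, Finsupp.linearCombination_apply, Finsupp.sum, map_sum, map_smul,
      ih]

/-- A family which is `O`-linear in every argument is determined by its values on words of basis
letters. -/
theorem basisExtend_basis {p : ℤ → M →ₗ[O] M} {e : ∀ i, ι i → M}
    (hc : ∀ i x, Finsupp.linearCombination O (e i) (c i x) = p i x) {q : Family M}
    (ha : q.IsAdditive) (hs : q.MapsSMul O)
    (hp : ∀ u i x v, q (u ++ (i, p i x) :: v) = q (u ++ (i, x) :: v)) (w : List (ℤ × M)) :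
    basisExtend c (fun l => q (l.map fun b => (b.1, e b.1 b.2))) w = q w := by
  induction w generalizing q with
  | nil => rfl
  | cons x w ih =>
    obtain ⟨i, x⟩ := x
    let g : M →ₗ[O] M :=
      { toFun := fun y => q ((i, y) :: w)
        map_add' := fun y z => ha [] i y z w
        map_smul' := fun f y => hs [] i f y w }
    have h1 : q ((i, x) :: w) = g (p i x) := (hp [] i x w).symm
    rw [h1, ← hc, Finsupp.linearCombination_apply, Finsupp.sum, map_sum, basisExtend_cons,
      Finsupp.linearCombination_apply, Finsupp.sum]
    refine Finset.sum_congr rfl fun b _ => ?_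
    rw [map_smul]
    congr 1
    exact ih (ha.part (i, e i b)) (hs.part _) fun u j y v => hp ((i, e i b) :: u) j y v

/-- The derivative along `δ` of the coordinates of the component of degree `i` of `x`: the flat
connection for which the basis vectors are horizontal. -/
noncomputable def basisConnection {K : Type*} [CommRing K] [Algebra K O]
    (c : ∀ i, M →ₗ[O] (ι i →₀ O)) (e : ∀ i, ι i → M) (δ : Derivation K O O) (i : ℤ) (x : M) : M :=
  Finsupp.linearCombination O (e i) ((c i x).mapRange δ (map_zero δ))

section Connection

variable {K : Type*} [CommRing K] [Algebra K O] {e : ∀ i, ι i → M}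

theorem basisConnection_add (δ : Derivation K O O) (i : ℤ) (x y : M) :
    basisConnection c e δ i (x + y) = basisConnection c e δ i x + basisConnection c e δ i y := by
  rw [basisConnection, map_add, Finsupp.mapRange_add (map_add δ), map_add]
  rfl

theorem basisConnection_eq_zero (δ : Derivation K O O) {i : ℤ} {x : M} (hx : c i x = 0) :
    basisConnection c e δ i x = 0 := by
  rw [basisConnection, hx, Finsupp.mapRange_zero, map_zero]

theorem basisConnection_add_left (δ δ' : Derivation K O O) (i : ℤ) (x : M) :
    basisConnection c e (δ + δ') i x =
      basisConnection c e δ i x + basisConnection c e δ' i x := by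
  rw [basisConnection, basisConnection, basisConnection, ← map_add]
  congr 1
  ext b
  simp

theorem basisConnection_smul_left (f : O) (δ : Derivation K O O) (i : ℤ) (x : M) :
    basisConnection c e (f • δ) i x = f • basisConnection c e δ i x := by
  rw [basisConnection, basisConnection, ← map_smul]
  congr 1
  ext b
  simp

theorem basisConnection_zero_left (i : ℤ) (x : M) :
    basisConnection c e (0 : Derivation K O O) i x = 0 := by
  simpa using basisConnection_smul_left (c := c) (e := e) 0 (0 : Derivation K O O) i x

theorem basisConnection_mem {N : Submodule O M} (δ : Derivation K O O) {i : ℤ}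
    (he : ∀ b, e i b ∈ N) (x : M) : basisConnection c e δ i x ∈ N := by
  rw [basisConnection, Finsupp.linearCombination_apply]
  exact N.sum_mem fun b _ => N.smul_mem _ (he b)

theorem basisConnection_smul {p : ℤ → M →ₗ[O] M}
    (hc : ∀ i x, Finsupp.linearCombination O (e i) (c i x) = p i x)
    (δ : Derivation K O O) (i : ℤ) (f : O) (x : M) :
    basisConnection c e δ i (f • x) = f • basisConnection c e δ i x + δ f • p i x := by
  rw [← hc, basisConnection, basisConnection, ← map_smul, ← map_smul, ← map_add]
  congr 1
  ext b
  simp [mul_comm]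

end Connection

end Extend

/-- The multiset of annotated degrees of a word. -/
def degrees {M : Type*} (w : List (ℤ × M)) : Multiset ℤ := (w.map Prod.fst : List ℤ)

theorem degrees_perm {M : Type*} {u v : List (ℤ × M)} (h : u.Perm v) : degrees u = degrees v :=
  Multiset.coe_eq_coe.mpr (h.map Prod.fst)

section Lift

variable {O M : Type*} [CommRing O] [AddCommGroup M] [Module O M]
  {𝓔 : ℤ → Submodule O M} {p : ℤ → M →ₗ[O] M}
  {ι : ℤ → Type*} {c : ∀ i, M →ₗ[O] (ι i →₀ O)} {e : ∀ i, ι i → M}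

/-- A symmetric `O`-multilinear family `J`, supported in total degree `D`, whose values are
boundaries, has a symmetric `O`-multilinear primitive with the same support: preimages are chosen
on words of basis letters, extended multilinearly, and averaged over permutations. -/
theorem exists_primitive (K : Type*) [Field K] [CharZero K] [Algebra K O]
    (hp : IsGradedProjection 𝓔 p)
    (hc : ∀ i x, Finsupp.linearCombination O (e i) (c i x) = p i x)
    (hc0 : ∀ i x, p i x = 0 → c i x = 0) (d : M →ₗ[O] M) (D : ℤ) (P : Multiset ℤ → Prop)
    (hP : ∀ s, P s → s.sum = D) {J : Family M} (hJ : IsBracketFamily p 2 J)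
    (hlin : J.MapsSMul O) (hJP : ∀ w, ¬ P (degrees w) → J w = 0)
    (hJd : ∀ w, ∃ y ∈ 𝓔 (D + 1), d y = J w) :
    ∃ h : Family M, IsBracketFamily p 1 h ∧ h.MapsSMul O ∧ (∀ w, d (h w) = J w) ∧
      ∀ w, ¬ P (degrees w) → h w = 0 := by
  classical
  choose y hy hyd using hJd
  let s : Family M :=
    Family.symmetrize (basisExtend c fun l => y (l.map fun b => (b.1, e b.1 b.2)))
  have hs : s.IsSymm := Family.isSymm_symmetrize _
  have hsadd := Family.symmetrize_first_add (M := M) (basisExtend_isAdditive (c := c)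
    fun l => y (l.map fun b => (b.1, e b.1 b.2)))
  have hssmul : s.MapsSMul O := Family.symmetrize_mapsSMul (basisExtend_mapsSMul _)
  have hsmem (w) : s w ∈ 𝓔 (D + 1) :=
    Family.symmetrize_mem (N := (𝓔 (D + 1)).toAddSubgroup)
      fun u _ => basisExtend_mem fun l => hy _
  have hsd (w) : d (s w) = w.length.factorial • J w := by
    rw [← hJ.symm.symmetrize]
    refine (Family.symmetrize_map d.toAddMonoidHom _ w).symm.trans ?_
    refine Family.symmetrize_congr fun u _ => ?_
    refine (map_basisExtend d _ u).trans ?_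
    simp only [hyd]
    exact basisExtend_basis hc hJ.add hlin (fun u i x v => hJ.map_proj hp u i x v) u
  -- The inverse of the number of permutations of the word, as an element of `O`.
  let r : List (ℤ × M) → O := fun w => algebraMap K O ((w.length.factorial : K)⁻¹)
  have hr (w : List (ℤ × M)) (m : M) : r w • (w.length.factorial • m) = m := by
    have : (w.length.factorial : K) ≠ 0 := by exact_mod_cast w.length.factorial_ne_zero
    rw [← Nat.cast_smul_eq_nsmul O, smul_smul, ← map_natCast (algebraMap K O), ← map_mul,
      inv_mul_cancel₀ this, map_one, one_smul]
  refine ⟨fun w => if P (degrees w) then r w • s w else 0, ?_, ?_, fun w => ?_, fun w hw => ?_⟩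
  · refine IsBracketFamily.of_first ?_ ?_ ?_ ?_
    · intro u a b v
      have hperm : (u ++ a :: b :: v).Perm (u ++ b :: a :: v) :=
        (List.Perm.swap b a v).append_left u
      have hr' : r (u ++ a :: b :: v) = r (u ++ b :: a :: v) := by simp [r]
      dsimp only
      rw [degrees_perm hperm, hr']
      split_ifs
      · rw [hs, smul_comm]
      · simp
    · intro i x x' v
      have h1 : degrees ((i, x + x') :: v) = degrees ((i, x) :: v) := rfl
      have h2 : degrees ((i, x') :: v) = degrees ((i, x) :: v) := rfl
      have h3 : r ((i, x + x') :: v) = r ((i, x) :: v) := rfl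
      have h4 : r ((i, x') :: v) = r ((i, x) :: v) := rfl
      simp only [h1, h2, h3, h4]
      split_ifs
      · rw [← smul_add]
        exact congrArg _ (hsadd i x x' v)
      · simp
    · intro w
      split_ifs with h
      · have : wordDegree w = D := by
          rw [← hP _ h, degrees, Multiset.sum_coe, wordDegree]
        rw [this, add_comm]
        exact hp.of_mem _ _ (Submodule.smul_mem _ _ (hsmem w))
      · simp
    · intro i x v h
      have : s ((i, x) :: v) = 0 :=
        Family.symmetrize_first_eq_zero (fun u v => basisExtend_eq_zero _ (hc0 i x h) u v) v
      simp [this]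
  · intro u i f x v
    have h1 : degrees (u ++ (i, f • x) :: v) = degrees (u ++ (i, x) :: v) := by simp [degrees]
    have h2 : r (u ++ (i, f • x) :: v) = r (u ++ (i, x) :: v) := by simp [r]
    simp only [h1, h2]
    split_ifs
    · rw [hssmul, smul_comm]
    · simp
  · dsimp only
    split_ifs with h
    · rw [map_smul, hsd, hr]
    · rw [map_zero, hJP w h]
  · simp [hw]

end Lift

/-! ### Inductive construction of the brackets -/

section Construction

theorem wordDegree_le {M : Type*} {w : List (ℤ × M)} (hw : ∀ x ∈ w, x.1 < 0) :
    wordDegree w ≤ -(w.length : ℤ) := by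
  induction w with
  | nil => simp
  | cons x w ih =>
    have h1 := hw x (by simp)
    have h2 := ih fun y hy => hw y (by simp [hy])
    simp only [wordDegree_cons, List.length_cons, Nat.cast_add, Nat.cast_one]
    omega


theorem IsBracketFamily.neg {O M : Type*} [CommRing O] [AddCommGroup M] [Module O M]
    {p : ℤ → M →ₗ[O] M} {a : ℤ} {q : Family M} (hq : IsBracketFamily p a q) :
    IsBracketFamily p a (-q) where
  symm u x y v := by simp [hq.symm u x y v]
  add u i x y v := by simp only [Pi.neg_apply, hq.add u i x y v]; abel
  homog w := by simp [hq.homog w]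
  proj u i x v h := by simp [hq.proj u i x v h]

theorem IsBracketFamily.cut {O M : Type*} [CommRing O] [AddCommGroup M] [Module O M]
    {p : ℤ → M →ₗ[O] M} {a : ℤ} {q : Family M} (hq : IsBracketFamily p a q)
    (P : Multiset ℤ → Prop) [DecidablePred P] :
    IsBracketFamily p a (fun w => if P (degrees w) then q w else 0) where
  symm u x y v := by
    have : (u ++ x :: y :: v).Perm (u ++ y :: x :: v) := (List.Perm.swap y x v).append_left u
    simp only [degrees_perm this, hq.symm u x y v, smul_ite, smul_zero]
  add u i x y v := by
    have h1 : degrees (u ++ (i, x + y) :: v) = degrees (u ++ (i, x) :: v) := by simp [degrees]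
    have h2 : degrees (u ++ (i, y) :: v) = degrees (u ++ (i, x) :: v) := by simp [degrees]
    simp only [h1, h2, hq.add u i x y v]
    split_ifs <;> simp
  homog w := by
    split_ifs
    · exact hq.homog w
    · simp
  proj u i x v h := by simp [hq.proj u i x v h]

variable {K O M : Type*} [Field K] [CommRing O] [Algebra K O] [AddCommGroup M]
  [Module O M]

/-- The data from which the brackets are constructed: a graded complex `(𝓔, d)`, exact in degrees
`≤ -2`, a Lie algebroid bracket `β` with anchor `ρ` in degree `-1`, both read off from the
components of degree `-1` of elements of `M`, for which the boundaries form an ideal. -/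
structure IsAlgebroidComplex (𝓔 : ℤ → Submodule O M) (p : ℤ → M →ₗ[O] M) (d : M →ₗ[O] M)
    (β : M → M → M) (ρ : M →ₗ[O] Derivation K O O) : Prop where
  proj : IsGradedProjection 𝓔 p
  proj_nonneg : ∀ i, 0 ≤ i → ∀ x, p i x = 0
  d_mem : ∀ i, ∀ x ∈ 𝓔 i, d x ∈ 𝓔 (i + 1)
  d_d : ∀ i, ∀ x ∈ 𝓔 i, d (d x) = 0
  exact : ∀ i ≤ -2, ∀ x ∈ 𝓔 i, d x = 0 → ∃ y ∈ 𝓔 (i - 1), d y = x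
  ideal : ∀ x, ∀ y ∈ 𝓔 (-2), ∃ z ∈ 𝓔 (-2), d z = β x (d y)
  β_add : ∀ x y z, β x (y + z) = β x y + β x z
  β_skew : ∀ x y, β x y = -β y x
  β_mem : ∀ x y, β x y ∈ 𝓔 (-1)
  β_proj : ∀ x y, p (-1) y = 0 → β x y = 0
  β_smul : ∀ x y f, β x (f • y) = f • β x y + ρ x f • p (-1) y
  β_jacobi : ∀ x y z, β x (β y z) + β y (β z x) + β z (β x y) = 0
  ρ_proj : ∀ x, p (-1) x = 0 → ρ x = 0
  ρ_d : ∀ y ∈ 𝓔 (-2), ρ (d y) = 0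
  ρ_β : ∀ x y, ρ (β x y) = ⁅ρ x, ρ y⁆

/-- The symbol of a Lie `∞`-algebroid: the anchor on words of a single letter of degree `-1`. -/
def anchorSymbol (ρ : M →ₗ[O] Derivation K O O) : List (ℤ × M) → Derivation K O O
  | [(i, x)] => if i = -1 then ρ x else 0
  | _ => 0

theorem anchorSymbol_degree (ρ : M →ₗ[O] Derivation K O O) (u : List (ℤ × M))
    (hu : 1 + wordDegree u ≠ 0) : anchorSymbol ρ u = 0 := by
  match u with
  | [] => rfl
  | [(i, x)] =>
    have : i ≠ -1 := by rintro rfl; simp at hu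
    simp [anchorSymbol, this]
  | _ :: _ :: _ => rfl

theorem anchorSymbol_of_length_ne_one {ρ : M →ₗ[O] Derivation K O O} {u : List (ℤ × M)}
    (h : u.length ≠ 1) : anchorSymbol ρ u = 0 := by
  match u with
  | [] => rfl
  | [_] => simp at h
  | _ :: _ :: _ => rfl

/-- Brackets satisfying all requirements except the higher Jacobi identities. -/
structure IsPrebracket (p : ℤ → M →ₗ[O] M) (d : M →ₗ[O] M) (β : M → M → M)
    (ρ : M →ₗ[O] Derivation K O O) (q : Family M) : Prop where
  family : IsBracketFamily p 1 q
  symbol : HasSymbol p q (anchorSymbol ρ)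
  unary : ∀ i x, q [(i, x)] = d (p i x)
  binary : ∀ x y, q [(-1, x), (-1, y)] = β x y
  higher : ∀ w : List (ℤ × M), 3 ≤ w.length → (∀ a ∈ w, a.1 = -1) → q w = 0

variable {𝓔 : ℤ → Submodule O M} {p : ℤ → M →ₗ[O] M} {d : M →ₗ[O] M} {β : M → M → M}
  {ρ : M →ₗ[O] Derivation K O O} {q : Family M}

theorem IsBracketFamily.eq_zero_of_nonneg {a : ℤ} {q : Family M}
    (hN : ∀ i, 0 ≤ i → ∀ x, p i x = 0) (hq : IsBracketFamily p a q) {w : List (ℤ × M)}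
    (h : ∃ x ∈ w, 0 ≤ x.1) : q w = 0 := by
  obtain ⟨⟨i, x⟩, hx, hi⟩ := h
  obtain ⟨u, v, rfl⟩ := List.append_of_mem hx
  exact hq.proj u i x v (hN i hi x)

theorem IsBracketFamily.eq_zero_of_degree {a : ℤ} {q : Family M}
    (hN : ∀ i, 0 ≤ i → ∀ x, p i x = 0) (hq : IsBracketFamily p a q) {w : List (ℤ × M)}
    (h : 0 ≤ a + wordDegree w) : q w = 0 := by
  rw [← hq.homog w, hN _ h]

namespace IsPrebracket

theorem square (hq : IsPrebracket p d β ρ q) : IsBracketFamily p 2 (q.comp 1 q) :=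
  hq.family.comp hq.family

theorem square_binary (hC : IsAlgebroidComplex 𝓔 p d β ρ) (hq : IsPrebracket p d β ρ q)
    (x y : M) : q.comp 1 q [(-1, x), (-2, y)] =
      d (q [(-1, x), (-2, y)]) - β x (d (p (-2) y)) := by
  have hnn {w : List (ℤ × M)} (h : ∃ x ∈ w, 0 ≤ x.1) : q w = 0 :=
    hq.family.eq_zero_of_nonneg hC.proj_nonneg h
  have e1 (m : M) : q [(-2, y), (0, m)] = 0 := hnn ⟨(0, m), by simp, le_rfl⟩
  have e2 : q [(-1, x), (-2, y), (1, q [])] = 0 := hnn ⟨(1, q []), by simp, zero_le_one⟩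
  have hm : p (-2) (q [(-1, x), (-2, y)]) = q [(-1, x), (-2, y)] := by
    have h := hq.family.homog [(-1, x), (-2, y)]
    rwa [show 1 + wordDegree [(-1, x), (-2, y)] = -2 by simp] at h
  have s1 : swapSign (-1) 1 = -1 := by decide
  have s2 : swapSign (-2) 1 = 1 := by decide
  simp only [Family.comp_cons, Family.comp_nil, Family.part_apply]
  norm_num [e1, e2, s1, s2, hm, hq.unary, hq.binary]
  abel

/-- The Jacobiator vanishes on words of letters of degree `-1`: for three letters this is the Jacobi
identity of the given bracket, and otherwise all terms vanish. -/
theorem square_unit_word (hC : IsAlgebroidComplex 𝓔 p d β ρ) (hq : IsPrebracket p d β ρ q)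
    {w : List (ℤ × M)} (hw : ∀ a ∈ w, a.1 = -1) : q.comp 1 q w = 0 := by
  have hnn {w : List (ℤ × M)} (h : ∃ x ∈ w, 0 ≤ x.1) : q w = 0 :=
    hq.family.eq_zero_of_nonneg hC.proj_nonneg h
  have hdeg (u : List (ℤ × M)) (hu : ∀ a ∈ u, a.1 = -1) : wordDegree u = -(u.length : ℤ) := by
    induction u with
    | nil => simp
    | cons x u ih =>
      rw [wordDegree_cons, ih fun a ha => hu a (by simp [ha]), hu x (by simp)]
      push_cast [List.length_cons]; ring
  by_cases h3 : w.length = 3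
  · obtain ⟨⟨i, x⟩, ⟨j, y⟩, ⟨k, z⟩, rfl⟩ := List.length_eq_three.mp h3
    obtain rfl : i = -1 := hw (i, x) (by simp)
    obtain rfl : j = -1 := hw (j, y) (by simp)
    obtain rfl : k = -1 := hw (k, z) (by simp)
    have s1 : swapSign (-1) 1 = -1 := by decide
    have s2 : swapSign (-1) (-1) = -1 := by decide
    have e0 : q [(-1, x), (-1, y), (-1, z)] = 0 := hq.higher _ (by simp) (by simp)
    have n1 (a b c : M) : q [(-1, a), (-1, b), (0, c)] = 0 := hnn ⟨(0, c), by simp, le_rfl⟩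
    have n2 (a b c f : M) : q [(-1, a), (-1, b), (-1, c), (1, f)] = 0 :=
      hnn ⟨(1, f), by simp, zero_le_one⟩
    have j1 := hC.β_jacobi x y z
    have j2 := hC.β_skew z x
    have hneg (u v : M) : β u (-v) = -β u v := by
      have h0 := hC.β_proj u 0 (map_zero _)
      have h1 := hC.β_add u v (-v)
      rw [add_neg_cancel, h0] at h1
      exact (neg_eq_of_add_eq_zero_right h1.symm).symm
    rw [j2, hneg] at j1
    simp only [Family.comp_cons, Family.comp_nil, Family.part_apply]
    norm_num [e0, n1, n2, s1, s2, hq.unary, hq.binary]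
    rw [← neg_eq_zero, ← j1]
    abel
  · refine Family.comp_eq_zero fun u v huv => ?_
    have hlen := huv.length_eq
    rw [List.length_append] at hlen
    have hu : ∀ a ∈ u, a.1 = -1 := fun a ha => hw a (huv.mem_iff.mp (by simp [ha]))
    have hv : ∀ a ∈ v, a.1 = -1 := fun a ha => hw a (huv.mem_iff.mp (by simp [ha]))
    -- The inner bracket of `u` has degree `1 - u.length`: it lands in a nonnegative degree for short
    -- `u`, vanishes for long `u`, and for two letters it is again of degree `-1`.
    have hdu := hdeg u hu
    rcases lt_or_ge u.length 2 with h | h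
    · exact hnn ⟨(1 + wordDegree u, q u), by simp, by dsimp only; omega⟩
    · rcases h.eq_or_lt with h | h
      · rcases v with _ | ⟨b, v⟩
        · rw [List.nil_append, hq.unary]
          have : 1 + wordDegree u = -1 := by omega
          rw [this, ← hC.proj.of_mem 0 (d _) (hC.d_mem (-1) _ (hC.proj.mem _ _)),
            hC.proj_nonneg 0 le_rfl]
        · refine hq.higher _ ?_ ?_
          · simp only [List.length_append, List.length_cons, List.length_nil] at hlen ⊢
            omega
          · intro a ha
            rw [List.mem_append, List.mem_singleton] at ha
            rcases ha with ha | rfl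
            · exact hv a ha
            · dsimp only; omega
      · rw [hq.higher u h hu]
        exact hq.family.add.map_zero v [] _

theorem square_unary (hC : IsAlgebroidComplex 𝓔 p d β ρ) (hq : IsPrebracket p d β ρ q)
    (i : ℤ) (x : M) : q.comp 1 q [(i, x)] = 0 := by
  have e : q [] = 0 := hq.family.eq_zero_of_degree hC.proj_nonneg (by simp)
  have e' : q [(i, x), (1, 0)] = 0 := hq.family.add.map_zero [(i, x)] [] 1
  simp only [Family.comp_cons, Family.comp_nil, Family.part_apply, e, e', hq.unary, smul_zero,
    add_zero]
  rw [hC.proj.of_mem (1 + i), hC.d_d i _ (hC.proj.mem _ _)]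
  rw [add_comm]
  exact hC.d_mem i _ (hC.proj.mem _ _)

theorem map_smul_of_length_ne_two (hq : IsPrebracket p d β ρ q)
    {u v : List (ℤ × M)} (h : (u ++ v).length ≠ 1) (i : ℤ) (f : O) (x : M) :
    q (u ++ (i, f • x) :: v) = f • q (u ++ (i, x) :: v) := by
  rw [hq.family.symm.move_last, hq.family.symm.move_last u v (i, x), hq.symbol,
    anchorSymbol_of_length_ne_one h, Derivation.zero_apply, zero_smul, add_zero, smul_comm]

/-- The Jacobiator is `O`-linear: its symbol vanishes because the anchor is a morphism of Lie
algebras which kills boundaries. -/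
theorem square_smul [CharZero K] (hC : IsAlgebroidComplex 𝓔 p d β ρ) (hq : IsPrebracket p d β ρ q)
    (w : List (ℤ × M)) (hw : ∀ a ∈ w, a.1 < 0) (i : ℤ) (f : O) (y : M) :
    q.comp 1 q (w ++ [(i, f • y)]) = f • q.comp 1 q (w ++ [(i, y)]) := by
  have hs : swapSign 1 1 = -1 := by decide
  -- For degree reasons only one letter of degree `-2` or two letters of degree `-1` contribute.
  have hT : symbolBracket 1 1 q q (anchorSymbol ρ) (anchorSymbol ρ) w = 0 := by
    by_cases h : 1 + 1 + wordDegree w = 0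
    · have hle := wordDegree_le hw
      match w, hw with
      | [], _ => simp at h
      | [(j, x)], _ =>
        obtain rfl : j = -2 := by simp at h; omega
        have := hC.ρ_d _ (hC.proj.mem (-2) x)
        simp [symbolBracket, anchorSymbol, hq.unary, this]
      | [(j, x), (k, z)], hw =>
        have hj := hw (j, x) (by simp)
        have hk := hw (k, z) (by simp)
        simp only [wordDegree_cons, wordDegree_nil] at h
        obtain rfl : j = -1 := by simp only at hj hk; omega
        obtain rfl : k = -1 := by simp only at hj hk; omega
        have s1 : swapSign (-1) 1 = -1 := by decide
        have s2 : swapSign 1 (-1) = -1 := by decide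
        simp [symbolBracket, anchorSymbol, hq.binary, hC.ρ_β, s1, s2]
        rw [← lie_skew (ρ x) (ρ z)]
        abel
      | _ :: _ :: _ :: _, _ =>
        simp only [List.length_cons, Nat.cast_add, Nat.cast_one] at hle
        omega
    · exact symbolBracket_eq_zero (anchorSymbol_degree ρ) (anchorSymbol_degree ρ) w h
  have h := HasSymbol.commutator hC.proj hq.family hq.family hq.symbol hq.symbol
    (anchorSymbol_degree ρ) (anchorSymbol_degree ρ) w i f y
  -- Since `q` is odd, its commutator with itself is twice its square.
  rw [hT, hs] at h
  simp only [neg_smul, one_smul, sub_neg_eq_add, Derivation.zero_apply, zero_smul, add_zero,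
    ← two_smul O] at h
  have h2 : algebraMap K O 2⁻¹ * 2 = 1 := by
    rw [← map_ofNat (algebraMap K O) 2, ← map_mul, inv_mul_cancel₀ two_ne_zero, map_one]
  have := congrArg (fun m => algebraMap K O 2⁻¹ • m) h
  simpa only [smul_smul, h2, one_smul, mul_left_comm _ f, mul_one] using this

end IsPrebracket

end Construction

/-! ### Obstruction theory in a fixed total degree -/

section Construction

variable {K O M : Type*} [Field K] [CommRing O] [Algebra K O] [AddCommGroup M]
  [Module O M] {𝓔 : ℤ → Submodule O M} {p : ℤ → M →ₗ[O] M} {d : M →ₗ[O] M} {β : M → M → M}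
  {ρ : M →ₗ[O] Derivation K O O} {q : Family M} {ι : ℤ → Type*}
  {c : ∀ i, M →ₗ[O] (ι i →₀ O)} {e : ∀ i, ι i → M}

/-- The degree sequences in total degree `D` in which the Jacobiator may have to be corrected: on the
other words it vanishes automatically, and no correction is made, so that the differential and the
brackets on degree `-1` are preserved. -/
def IsCorrectionDegree (D : ℤ) (s : Multiset ℤ) : Prop :=
  s.sum = D ∧ (∀ i ∈ s, i < 0) ∧ 2 ≤ s.card ∧ ∃ i ∈ s, i ≠ -1

theorem sum_degrees {M : Type*} (w : List (ℤ × M)) : (degrees w).sum = wordDegree w := rfl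

theorem mem_degrees {M : Type*} {w : List (ℤ × M)} {i : ℤ} :
    i ∈ degrees w ↔ ∃ a ∈ w, a.1 = i := by simp [degrees]

theorem IsPrebracket.square_eq_zero_of_degree (hC : IsAlgebroidComplex 𝓔 p d β ρ)
    (hq : IsPrebracket p d β ρ q) {D : ℤ} {w : List (ℤ × M)} (hw : wordDegree w = D)
    (h : ¬ IsCorrectionDegree D (degrees w)) : q.comp 1 q w = 0 := by
  by_cases h1 : ∃ x ∈ w, 0 ≤ x.1
  · exact hq.square.eq_zero_of_nonneg hC.proj_nonneg h1
  push Not at h1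
  match w with
  | [] => exact hq.square.eq_zero_of_degree hC.proj_nonneg (by simp)
  | [(i, x)] => exact hq.square_unary hC i x
  | a :: b :: w =>
    refine hq.square_unit_word hC fun x hx => ?_
    by_contra hne
    refine h ⟨by rw [sum_degrees, hw], fun i hi => ?_, by simp [degrees],
      ⟨x.1, mem_degrees.mpr ⟨x, hx, rfl⟩, hne⟩⟩
    obtain ⟨y, hy, rfl⟩ := mem_degrees.mp hi
    exact h1 y hy

/-- If the Jacobiator vanishes in total degrees above `D`, then in degree `D` it takes values in
boundaries: by the Bianchi identity it is a cycle. -/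
theorem IsPrebracket.square_boundary [CharZero K] (hC : IsAlgebroidComplex 𝓔 p d β ρ)
    (hq : IsPrebracket p d β ρ q) {D : ℤ} {w : List (ℤ × M)}
    (hJ : ∀ u, D < wordDegree u → q.comp 1 q u = 0) (hD : IsCorrectionDegree D (degrees w)) :
    ∃ y ∈ 𝓔 (D + 1), d y = q.comp 1 q w := by
  have hw : wordDegree w = D := by rw [← hD.1, sum_degrees]
  have hneg : ∀ a ∈ w, a.1 < 0 := fun a ha => hD.2.1 _ (mem_degrees.mpr ⟨a, ha, rfl⟩)
  rcases lt_trichotomy D (-3) with h | h | h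
  · have hmem := hq.square.mem hC.proj w
    rw [hw] at hmem
    have htf : IsAddTorsionFree M := by
      have : Module ℚ M := Module.compHom M ((algebraMap K O).comp (algebraMap ℚ K))
      exact IsAddTorsionFree.of_module_rat M
    have hB := Family.comp_comp_self hq.family.symm hq.family.add w
    rw [Family.comp_eq_zero, Family.comp_eq_single, hq.unary, hw,
      hC.proj.of_mem _ _ hmem] at hB
    · obtain ⟨y, hy, hyd⟩ := hC.exact (2 + D) (by omega) _ hmem hB.symm
      exact ⟨y, by convert hy using 2; ring, hyd⟩
    · intro u v huv hv
      have hdeg := wordDegree_perm huv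
      rw [wordDegree_append] at hdeg
      have hvn : wordDegree v ≤ -(v.length : ℤ) :=
        wordDegree_le fun a ha => hneg a (huv.mem_iff.mp (by simp [ha]))
      have hvl := List.length_pos_iff.mpr hv
      rw [hJ u (by omega)]
      exact hq.family.add.map_zero v [] _
    · intro u v huv
      have hdeg := wordDegree_perm huv
      rw [wordDegree_append] at hdeg
      refine hJ _ ?_
      simp only [wordDegree_append, wordDegree_cons, wordDegree_nil]
      omega
  -- In degree `-3` the value is in degree `-1`, where not every cycle of `d` is a boundary.
  · have key (x y : M) : ∃ z ∈ 𝓔 (D + 1), d z = q.comp 1 q [(-1, x), (-2, y)] := by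
      obtain ⟨z, hz, hzd⟩ := hC.ideal x (p (-2) y) (hC.proj.mem _ _)
      refine ⟨q [(-1, x), (-2, y)] - z, ?_, ?_⟩
      · have h1 := hq.family.mem hC.proj [(-1, x), (-2, y)]
        rw [show 1 + wordDegree [(-1, x), (-2, y)] = -2 by simp] at h1
        rw [h]
        exact Submodule.sub_mem _ h1 hz
      · rw [map_sub, hzd, hq.square_binary hC]
    obtain ⟨-, -, h2, j, hj, hj1⟩ := hD
    have hle := wordDegree_le hneg
    match w, hneg with
    | [], _ => simp [degrees] at h2
    | [_], _ => simp [degrees] at h2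
    | [(i, x), (k, y)], hneg =>
      have hi := hneg (i, x) (by simp)
      have hk := hneg (k, y) (by simp)
      simp only [wordDegree_cons, wordDegree_nil] at hw hi hk
      have : i = -1 ∧ k = -2 ∨ i = -2 ∧ k = -1 := by omega
      rcases this with ⟨rfl, rfl⟩ | ⟨rfl, rfl⟩
      · exact key x y
      · obtain ⟨z, hz, hzd⟩ := key y x
        refine ⟨z, hz, ?_⟩
        have := hq.square.symm [] (-2, x) (-1, y) []
        dsimp only at this
        rw [show swapSign (-2) (-1) = 1 by decide, one_smul] at this
        exact hzd.trans this.symm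
    | a :: b :: f :: g :: _, _ =>
      simp only [List.length_cons, Nat.cast_add, Nat.cast_one] at hle
      omega
    | [a, b, f], hneg =>
      obtain ⟨x, hx, rfl⟩ := mem_degrees.mp hj
      have ha := hneg a (by simp)
      have hb := hneg b (by simp)
      have hf := hneg f (by simp)
      simp only [wordDegree_cons, wordDegree_nil] at hw
      simp only [List.mem_cons, List.not_mem_nil, or_false] at hx
      rcases hx with rfl | rfl | rfl <;> omega
  · refine ⟨0, Submodule.zero_mem _, ?_⟩
    rw [map_zero, hq.square.eq_zero_of_degree hC.proj_nonneg]
    omega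

/-- The inductive step: a Jacobiator vanishing above total degree `D` can be made to vanish in
degree `D` too, by changing the brackets in total degrees at most `D`. -/
theorem IsPrebracket.exists_correction [CharZero K] (hC : IsAlgebroidComplex 𝓔 p d β ρ)
    (hc : ∀ i x, Finsupp.linearCombination O (e i) (c i x) = p i x)
    (hc0 : ∀ i x, p i x = 0 → c i x = 0) (hq : IsPrebracket p d β ρ q) {D : ℤ}
    (hJ : ∀ u, D < wordDegree u → q.comp 1 q u = 0) :
    ∃ q' : Family M, IsPrebracket p d β ρ q' ∧ (∀ u, D < wordDegree u → q' u = q u) ∧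
      ∀ u, D ≤ wordDegree u → q'.comp 1 q' u = 0 := by
  classical
  have hcut := hq.square.cut (IsCorrectionDegree D)
  have hlin : Family.MapsSMul O
      (fun w => if IsCorrectionDegree D (degrees w) then q.comp 1 q w else 0) := by
    intro u i f x v
    have hdeg : degrees (u ++ (i, f • x) :: v) = degrees (u ++ (i, x) :: v) := by simp [degrees]
    simp only [hdeg]
    split_ifs with h
    · rw [hq.square.symm.move_last, hq.square.symm.move_last u v (i, x),
        hq.square_smul hC, smul_comm]
      intro a ha
      refine h.2.1 _ (mem_degrees.mpr ⟨a, ?_, rfl⟩)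
      simp only [List.mem_append, List.mem_cons] at ha ⊢
      tauto
    · simp
  obtain ⟨h, hh, hhlin, hhd, hh0⟩ := exists_primitive K hC.proj hc hc0 d D
    (IsCorrectionDegree D) (fun s hs => hs.1) hcut hlin (fun w hw => if_neg hw) fun w => by
      by_cases hw : IsCorrectionDegree D (degrees w)
      · simpa only [if_pos hw] using hq.square_boundary hC hJ hw
      · exact ⟨0, Submodule.zero_mem _, by simp [hw]⟩
  have hdeg0 (w : List (ℤ × M)) (hw : wordDegree w ≠ D) : (-h) w = 0 := by
    rw [Pi.neg_apply, hh0 w fun hD => hw (by rw [← hD.1, sum_degrees]), neg_zero]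
  have hq' : IsPrebracket p d β ρ (q + -h) := by
    refine ⟨hq.family.addFamily hh.neg, fun u i f y => ?_, fun i x => ?_, fun x y => ?_,
      fun w hw1 hw2 => ?_⟩
    · have h1 := hq.symbol u i f y
      have h2 := hhlin u i f y []
      simp only [Pi.add_apply, Pi.neg_apply, h1, h2, smul_add, smul_neg]
      abel
    · rw [Pi.add_apply, hq.unary, Pi.neg_apply, hh0, neg_zero, add_zero]
      intro hD
      have := hD.2.2.1
      simp [degrees] at this
    · rw [Pi.add_apply, hq.binary, Pi.neg_apply, hh0, neg_zero, add_zero]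
      rintro ⟨-, -, -, i, hi, hi1⟩
      obtain ⟨a, ha, rfl⟩ := mem_degrees.mp hi
      simp only [List.mem_cons, List.not_mem_nil, or_false] at ha
      rcases ha with rfl | rfl <;> exact hi1 rfl
    · rw [Pi.add_apply, hq.higher w hw1 hw2, Pi.neg_apply, hh0, neg_zero, add_zero]
      rintro ⟨-, -, -, i, hi, hi1⟩
      obtain ⟨a, ha, rfl⟩ := mem_degrees.mp hi
      exact hi1 (hw2 a ha)
  refine ⟨q + -h, hq', fun u hu => by rw [Pi.add_apply, hdeg0 u hu.ne', add_zero],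
    fun w hw => ?_⟩
  by_cases hneg : ∃ x ∈ w, 0 ≤ x.1
  · exact hq'.square.eq_zero_of_nonneg hC.proj_nonneg hneg
  push Not at hneg
  -- Inserting anything into the correction raises the total degree above `D`.
  have hz (r : Family M) : Family.comp 1 (-h) r w = 0 := by
    refine Family.comp_eq_zero fun u v huv => hdeg0 _ ?_
    have hdeg := wordDegree_perm huv
    simp only [wordDegree_append, wordDegree_cons, wordDegree_nil] at hdeg ⊢
    omega
  -- Only the differential is applied to a value of the correction: with letters left over, the
  -- correction would be evaluated above total degree `D`.
  have hs : Family.comp 1 q (-h) w = d ((-h) w) := by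
    rw [Family.comp_eq_single, hq.unary, hh.neg.homog]
    intro u v huv hv
    have hdeg := wordDegree_perm huv
    rw [wordDegree_append] at hdeg
    have hvn : wordDegree v ≤ -(v.length : ℤ) :=
      wordDegree_le fun a ha => hneg a (huv.mem_iff.mp (by simp [ha]))
    have hvl := List.length_pos_iff.mpr hv
    rw [hdeg0 u (by omega)]
    exact hq.family.add.map_zero v [] _
  rw [Family.comp_add_right _ hq'.family.add, Family.comp_add_left, Family.comp_add_left]
  simp only [Pi.add_apply, hz, hs, add_zero]
  rw [Pi.neg_apply, map_neg, hhd]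
  split_ifs with hD
  · exact add_neg_cancel _
  · rw [neg_zero, add_zero]
    rcases hw.eq_or_lt with h | h
    · exact hq.square_eq_zero_of_degree hC h.symm hD
    · exact hJ w h

end Construction

/-! ### The initial brackets and the limit of the corrections -/

section Construction

variable {K O M : Type*} [Field K] [CommRing O] [Algebra K O] [AddCommGroup M]
  [Module O M] {𝓔 : ℤ → Submodule O M} {p : ℤ → M →ₗ[O] M} {d : M →ₗ[O] M} {β : M → M → M}
  {ρ : M →ₗ[O] Derivation K O O} {ι : ℤ → Type*}
  {c : ∀ i, M →ₗ[O] (ι i →₀ O)} {e : ∀ i, ι i → M}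

/-- The first approximation to the brackets: the differential, the given bracket on degree `-1`,
and the flat connection of a basis for the bracket of degree `-1` with other degrees. -/
noncomputable def initialBracket (p : ℤ → M →ₗ[O] M) (d : M →ₗ[O] M) (β : M → M → M)
    (ρ : M →ₗ[O] Derivation K O O) (c : ∀ i, M →ₗ[O] (ι i →₀ O)) (e : ∀ i, ι i → M) : Family M
  | [(i, x)] => d (p i x)
  | [(i, x), (j, y)] =>
    if i = -1 then if j = -1 then β x y else basisConnection c e (ρ x) j y
    else if j = -1 then swapSign i j • basisConnection c e (ρ y) i x else 0
  | _ => 0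

theorem isPrebracket_initialBracket (hC : IsAlgebroidComplex 𝓔 p d β ρ)
    (hc : ∀ i x, Finsupp.linearCombination O (e i) (c i x) = p i x)
    (hc0 : ∀ i x, p i x = 0 → c i x = 0) (he : ∀ i b, e i b ∈ 𝓔 i) :
    IsPrebracket p d β ρ (initialBracket p d β ρ c e) := by
  have s1 : swapSign (-1) (-1) = -1 := by decide
  refine ⟨IsBracketFamily.of_first ?_ ?_ ?_ ?_, ?_, fun i x => rfl, fun x y => ?_, ?_⟩
  · rintro (_ | ⟨z, _ | ⟨z', u⟩⟩) ⟨i, x⟩ ⟨j, y⟩ (_ | ⟨z'', v⟩)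
    · simp only [List.nil_append, initialBracket]
      by_cases hi : i = -1 <;> by_cases hj : j = -1
      · subst hi hj
        simp only [if_true, s1, neg_smul, one_smul, hC.β_skew x y]
      · subst hi
        simp [hj, smul_smul, swapSign_mul_swapSign_comm]
      · subst hj
        simp [hi]
      · simp [hi, hj]
    all_goals simp [initialBracket]
  · rintro i x y (_ | ⟨⟨j, z⟩, _ | ⟨z', v⟩⟩)
    · simp [initialBracket]
    · simp only [initialBracket]
      split_ifs
      · rw [hC.β_skew, hC.β_add, hC.β_skew x z, hC.β_skew y z]
        abel
      · rw [map_add, basisConnection_add_left]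
      · rw [basisConnection_add, smul_add]
      · simp
    · simp [initialBracket]
  · intro w
    refine hC.proj.of_mem _ _ ?_
    match w with
    | [] => exact Submodule.zero_mem _
    | [(i, x)] =>
      have := hC.d_mem i _ (hC.proj.mem i x)
      simpa [initialBracket, add_comm] using this
    | [(i, x), (j, y)] =>
      simp only [initialBracket]
      split_ifs with h1 h2 h2
      · subst h1 h2
        simpa using hC.β_mem x y
      · subst h1
        have := basisConnection_mem (c := c) (ρ x) (he j) y
        simpa using this
      · subst h2
        have := basisConnection_mem (c := c) (ρ y) (he i) x
        rw [show 1 + wordDegree [(i, x), (-1, y)] = i by simp]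
        exact Submodule.smul_of_tower_mem _ _ this
      · exact Submodule.zero_mem _
    | _ :: _ :: _ :: _ => exact Submodule.zero_mem _
  · rintro i x (_ | ⟨⟨j, z⟩, _ | ⟨z', v⟩⟩) h
    · simp [initialBracket, h]
    · simp only [initialBracket]
      split_ifs with h1 h2 h2
      · subst h1
        rw [hC.β_skew, hC.β_proj z x h, neg_zero]
      · subst h1
        rw [hC.ρ_proj x h, basisConnection_zero_left]
      · rw [basisConnection_eq_zero _ (hc0 i x h), smul_zero]
      · rfl
    · rfl
  · rintro (_ | ⟨⟨j, z⟩, _ | ⟨z', u⟩⟩) i f x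
    · simp [initialBracket, anchorSymbol]
    · simp only [initialBracket, anchorSymbol, List.cons_append, List.nil_append]
      split_ifs with h1 h2 h2
      · subst h2
        exact hC.β_smul z x f
      · exact basisConnection_smul hc (ρ z) i f x
      · rw [map_smul, basisConnection_smul_left, smul_comm]
        simp
      · simp
    · cases u <;> simp [initialBracket, anchorSymbol]
  · simp [initialBracket]
  · intro w hw _
    match w with
    | [] => simp at hw
    | [_] => simp at hw
    | [_, _] => simp at hw
    | _ :: _ :: _ :: _ => rfl

/-- Brackets satisfying all higher Jacobi identities exist: the corrections made in total degree
`D` do not affect the brackets in degrees above `D`, so that the successive approximations converge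
degreewise. -/
theorem exists_isPrebracket_comp_eq_zero [CharZero K] (hC : IsAlgebroidComplex 𝓔 p d β ρ)
    (hc : ∀ i x, Finsupp.linearCombination O (e i) (c i x) = p i x)
    (hc0 : ∀ i x, p i x = 0 → c i x = 0) (he : ∀ i b, e i b ∈ 𝓔 i) :
    ∃ q : Family M, IsPrebracket p d β ρ q ∧ ∀ w, q.comp 1 q w = 0 := by
  let T (n : ℕ) := {q : Family M // IsPrebracket p d β ρ q ∧
    ∀ u, -(n : ℤ) ≤ wordDegree u → q.comp 1 q u = 0}
  have hstep (n : ℕ) (q : T n) :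
      ∃ q' : T (n + 1), ∀ u, -(n : ℤ) ≤ wordDegree u → q'.1 u = q.1 u := by
    obtain ⟨q', h1, h2, h3⟩ := q.2.1.exists_correction hC hc hc0 (D := -((n + 1 : ℕ) : ℤ))
      fun u hu => q.2.2 u (by push_cast at hu; omega)
    exact ⟨⟨q', h1, h3⟩, fun u hu => h2 u (by push_cast; omega)⟩
  choose next hnext using hstep
  have h0 := isPrebracket_initialBracket hC hc hc0 he
  obtain ⟨a, hP, haJ, ha⟩ : ∃ a : ℕ → Family M, (∀ n, IsPrebracket p d β ρ (a n)) ∧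
      (∀ (n : ℕ) u, -(n : ℤ) ≤ wordDegree u → (a n).comp 1 (a n) u = 0) ∧
      ∀ (n : ℕ) u, -(n : ℤ) ≤ wordDegree u → a (n + 1) u = a n u := by
    let a : ∀ n, T n := fun n => Nat.rec ⟨_, h0, fun u hu =>
      h0.square.eq_zero_of_degree hC.proj_nonneg (by push_cast at hu; omega)⟩ next n
    exact ⟨fun n => (a n).1, fun n => (a n).2.1, fun n => (a n).2.2, fun n => hnext n (a n)⟩
  obtain ⟨q, hqa⟩ : ∃ q : Family M, ∀ (n : ℕ) w, -(n : ℤ) ≤ wordDegree w → q w = a n w := by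
    refine ⟨fun w => a (-wordDegree w).toNat w, fun n w hn => ?_⟩
    have hn' : (-wordDegree w).toNat ≤ n := by omega
    induction n, hn' using Nat.le_induction with
    | base => rfl
    | succ n hn' ih => exact (ih (by omega)).trans (ha n w (by omega)).symm
  have hbound (w : List (ℤ × M)) : -((-wordDegree w).toNat : ℤ) ≤ wordDegree w := by omega
  have hq : IsPrebracket p d β ρ q := by
    refine ⟨⟨fun u x y v => ?_, fun u i x y v => ?_, fun w => ?_, fun u i x v h => ?_⟩,
      fun u i f y => ?_, fun i x => ?_, fun x y => ?_, fun w h1 h2 => ?_⟩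
    · have h := hbound (u ++ x :: y :: v)
      rw [hqa _ _ h, (hP _).family.symm, ← hqa]
      rwa [wordDegree_perm ((List.Perm.swap x y v).append_left u)]
    · have h := hbound (u ++ (i, x + y) :: v)
      rw [hqa _ _ h, (hP _).family.add, ← hqa, ← hqa] <;> simpa using h
    · rw [hqa _ _ (hbound w), (hP _).family.homog]
    · rw [hqa _ _ (hbound _), (hP _).family.proj u i x v h]
    · have h := hbound (u ++ [(i, f • y)])
      rw [hqa _ _ h, (hP _).symbol, ← hqa]
      simpa using h
    · rw [hqa _ _ (hbound _), (hP _).unary]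
    · rw [hqa _ _ (hbound _), (hP _).binary]
    · rw [hqa _ _ (hbound _), (hP _).higher w h1 h2]
  refine ⟨q, hq, fun w => ?_⟩
  by_cases hneg : ∃ x ∈ w, 0 ≤ x.1
  · exact hq.square.eq_zero_of_nonneg hC.proj_nonneg hneg
  push Not at hneg
  rw [← haJ _ w (hbound w)]
  refine Family.comp_congr fun u v huv => ?_
  have hdeg := wordDegree_perm huv
  rw [wordDegree_append] at hdeg
  have hvn : wordDegree v ≤ -(v.length : ℤ) :=
    wordDegree_le fun x hx => hneg x (huv.mem_iff.mp (by simp [hx]))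
  have hb := hbound w
  rw [hqa (-wordDegree w).toNat u (by omega), hqa]
  simp only [wordDegree_append, wordDegree_cons, wordDegree_nil]
  omega

end Construction

/-! ### Koszul signs of permutations -/

section Koszul

variable {n : ℕ}

theorem koszulSign_eq_prod (d : Fin n → ℤ) (σ : Equiv.Perm (Fin n)) :
    koszulSign d σ = ∏ a : Fin n, ∏ b : Fin n,
      if a < b ∧ σ b < σ a then swapSign (d (σ a)) (d (σ b)) else 1 := rfl

/-- A product over ordered pairs of a symmetric function does not change when the indices are
permuted. -/
theorem prod_pairs_comp (F : Fin n → Fin n → ℤ) (hF : ∀ a b, F a b = F b a)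
    (τ : Equiv.Perm (Fin n)) :
    ∏ a, ∏ b, (if a < b then F (τ a) (τ b) else 1) = ∏ a, ∏ b, if a < b then F a b else 1 := by
  have key (G : Fin n → Fin n → ℤ) (hG : ∀ a b, G a b = G b a) :
      ∏ a, ∏ b, (if a < b then G a b else 1) =
        ∏ z : Sym2 (Fin n) with ¬ z.IsDiag, Sym2.lift ⟨G, hG⟩ z := by
    have h := Finset.sum_sym2_filter_not_isDiag (Finset.univ : Finset (Fin n))
      (fun z => Additive.ofMul (Sym2.lift ⟨G, hG⟩ z))
    rw [Finset.sym2_univ, ← ofMul_prod, ← ofMul_prod] at h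
    rw [Additive.ofMul.injective h, ← Finset.prod_product', ← Finset.prod_filter]
    refine Finset.prod_congr ?_ fun x _ => rfl
    ext ⟨a, b⟩
    simp only [Finset.mem_filter, Finset.mem_product, Finset.mem_univ, true_and,
      Finset.mem_offDiag]
    exact ⟨fun h => ⟨h.ne, h⟩, fun h => h.2⟩
  rw [key (fun a b => F (τ a) (τ b)) fun a b => hF _ _, key F hF]
  refine Finset.prod_nbij' (Sym2.map τ) (Sym2.map τ.symm) (fun z hz => ?_) (fun z hz => ?_)
    (fun z _ => ?_) (fun z _ => ?_) fun z _ => ?_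
  · simpa [Sym2.isDiag_map τ.injective] using hz
  · simpa [Sym2.isDiag_map τ.symm.injective] using hz
  · simp [Sym2.map_map]
  · simp [Sym2.map_map]
  · induction z with | _ a b => simp

/-- Koszul signs satisfy the cocycle identity. -/
theorem koszulSign_mul (d : Fin n → ℤ) (σ τ : Equiv.Perm (Fin n)) :
    koszulSign d (σ * τ) = koszulSign d σ * koszulSign (d ∘ σ) τ := by
  -- The contribution to the sign of `σ` of an unordered pair of indices.
  let F : Fin n → Fin n → ℤ := fun a b =>
    if (a < b ∧ σ b < σ a) ∨ (b < a ∧ σ a < σ b) then swapSign (d (σ a)) (d (σ b)) else 1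
  have hF (a b) : F a b = F b a := by
    simp only [F, swapSign_comm (d (σ a)) (d (σ b))]
    congr 1
    exact propext or_comm
  have h1 : koszulSign d σ = ∏ a, ∏ b, if a < b then F a b else 1 := by
    rw [koszulSign_eq_prod]
    refine Finset.prod_congr rfl fun a _ => Finset.prod_congr rfl fun b _ => ?_
    simp only [F]
    split_ifs <;> first | rfl | (exfalso; omega)
  rw [h1, ← prod_pairs_comp F hF τ, koszulSign_eq_prod, koszulSign_eq_prod,
    ← Finset.prod_mul_distrib]
  refine Finset.prod_congr rfl fun a _ => ?_
  rw [← Finset.prod_mul_distrib]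
  refine Finset.prod_congr rfl fun b _ => ?_
  simp only [F, Equiv.Perm.mul_apply, Function.comp_apply]
  by_cases hab : a < b
  · have h2 : τ a ≠ τ b := fun h => hab.ne (τ.injective h)
    have h3 : σ (τ a) ≠ σ (τ b) := fun h => h2 (σ.injective h)
    rcases lt_or_gt_of_ne h2 with h2 | h2 <;> rcases lt_or_gt_of_ne h3 with h3 | h3 <;>
      simp [hab, h2, h3, h2.not_gt, h3.not_gt]
  · simp [hab]

theorem koszulSign_one (d : Fin n → ℤ) : koszulSign d 1 = 1 := by
  rw [koszulSign_eq_prod]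
  refine Finset.prod_eq_one fun a _ => Finset.prod_eq_one fun b _ => if_neg ?_
  rintro ⟨h1, h2⟩
  exact lt_asymm h1 h2

theorem koszulSign_swap (d : Fin (n + 1) → ℤ) (i : Fin n) :
    koszulSign d (Equiv.swap i.castSucc i.succ) = swapSign (d i.castSucc) (d i.succ) := by
  have hlt : i.castSucc < i.succ := Fin.castSucc_lt_succ
  have hz (a b : Fin (n + 1)) (h : ¬ (a = i.castSucc ∧ b = i.succ)) :
      ¬ (a < b ∧ Equiv.swap i.castSucc i.succ b < Equiv.swap i.castSucc i.succ a) := by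
    rintro ⟨h1, h2⟩
    rw [Equiv.swap_apply_def, Equiv.swap_apply_def] at h2
    simp only [Fin.ext_iff, Fin.lt_def, Fin.val_castSucc, Fin.val_succ] at h h1 h2
    split_ifs at h2 <;> try simp only [Fin.val_castSucc, Fin.val_succ] at h2
    all_goals omega
  rw [koszulSign_eq_prod, Finset.prod_eq_single i.castSucc, Finset.prod_eq_single i.succ]
  · simp [hlt, swapSign_comm]
  · exact fun b _ hb => if_neg (hz _ _ fun h => hb h.2)
  · simp
  · exact fun a _ ha => Finset.prod_eq_one fun b _ => if_neg (hz _ _ fun h => ha h.1)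
  · simp

/-- Exchange of adjacent letters generates the graded symmetry under arbitrary permutations. -/
theorem Family.IsSymm.apply_perm {M : Type*} [AddCommGroup M] {q : Family M} (hq : q.IsSymm)
    (x : Fin n → ℤ × M) (σ : Equiv.Perm (Fin n)) :
    q (List.ofFn fun a => x (σ a)) =
      koszulSign (fun a => (x a).1) σ • q (List.ofFn x) := by
  obtain _ | n := n
  · rw [Subsingleton.elim σ 1, koszulSign_one, one_smul]
    rfl
  have hswap (y : Fin (n + 1) → ℤ × M) (i : Fin n) :
      q (List.ofFn fun a => y (Equiv.swap i.castSucc i.succ a)) =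
        swapSign (y i.castSucc).1 (y i.succ).1 • q (List.ofFn y) := by
    have split (z : Fin (n + 1) → ℤ × M) : List.ofFn z = (List.ofFn z).take i ++
        z i.castSucc :: z i.succ :: (List.ofFn z).drop (i + 2) := by
      have h1 : (i : ℕ) < (List.ofFn z).length := by simp
      have h2 : (i : ℕ) + 1 < (List.ofFn z).length := by simp
      conv_lhs => rw [← List.take_append_drop i (List.ofFn z), List.drop_eq_getElem_cons h1,
        List.drop_eq_getElem_cons h2]
      simp only [List.getElem_ofFn]
      rfl
    have e1 : (List.ofFn fun a => y (Equiv.swap i.castSucc i.succ a)).take i =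
        (List.ofFn y).take i := by
      refine List.ext_getElem (by simp) fun k h1 h2 => ?_
      simp only [List.getElem_take, List.getElem_ofFn]
      rw [List.length_take] at h1
      rw [Equiv.swap_apply_of_ne_of_ne] <;> simp only [ne_eq, Fin.ext_iff, Fin.val_castSucc,
        Fin.val_succ] <;> omega
    have e2 : (List.ofFn fun a => y (Equiv.swap i.castSucc i.succ a)).drop (i + 2) =
        (List.ofFn y).drop (i + 2) := by
      refine List.ext_getElem (by simp) fun k h1 h2 => ?_
      simp only [List.getElem_drop, List.getElem_ofFn]
      rw [Equiv.swap_apply_of_ne_of_ne] <;> simp only [ne_eq, Fin.ext_iff, Fin.val_castSucc,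
        Fin.val_succ] <;> omega
    rw [split fun a => y (Equiv.swap i.castSucc i.succ a), e1, e2, Equiv.swap_apply_left,
      Equiv.swap_apply_right, hq, ← split y, swapSign_comm]
  have hmem : σ ∈ Submonoid.closure
      (Set.range fun i : Fin n => Equiv.swap i.castSucc i.succ) := by
    rw [Equiv.Perm.mclosure_swap_castSucc_succ]
    trivial
  induction hmem using Submonoid.closure_induction_right with
  | one => simp [koszulSign_one]
  | mul_right σ _ τ hτ ih =>
    obtain ⟨i, rfl⟩ := hτ
    rw [koszulSign_mul, koszulSign_swap, mul_comm, mul_smul, ← ih]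
    exact hswap (fun a => x (σ a)) i

end Koszul

/-! ### Compositions as sums over shuffles -/

section Shuffles

variable {n : ℕ}

/-- The Koszul sign of moving the letters with index in `S` to the front of the word whose letters
are indexed by a list, `d` being the degrees of the letters. -/
def unshuffleSign (d : Fin n → ℤ) (S : Finset (Fin n)) : List (Fin n) → ℤ
  | [] => 1
  | b :: L => (if b ∈ S then 1 else swapSign (d b) ((L.filter (· ∈ S)).map d).sum) *
      unshuffleSign d S L

theorem unshuffleSign_congr (d : Fin n → ℤ) {S S' : Finset (Fin n)} {L : List (Fin n)}
    (h : ∀ b ∈ L, b ∈ S ↔ b ∈ S') : unshuffleSign d S L = unshuffleSign d S' L := by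
  induction L with
  | nil => rfl
  | cons b L ih =>
    have hf : L.filter (· ∈ S) = L.filter (· ∈ S') :=
      List.filter_congr fun a ha => by simp [h a (by simp [ha])]
    rw [unshuffleSign, unshuffleSign, ih fun a ha => h a (by simp [ha]), hf]
    simp only [h b (by simp)]

theorem unshuffleSign_eq_prod (d : Fin n → ℤ) (S : Finset (Fin n)) {L : List (Fin n)}
    (hL : L.Pairwise (· < ·)) :
    unshuffleSign d S L = (L.map fun b => (L.map fun a =>
      if b < a ∧ b ∉ S ∧ a ∈ S then swapSign (d b) (d a) else 1).prod).prod := by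
  induction L with
  | nil => rfl
  | cons b L ih =>
    rw [List.pairwise_cons] at hL
    have h1 : ((b :: L).map fun a =>
        if b < a ∧ b ∉ S ∧ a ∈ S then swapSign (d b) (d a) else 1).prod =
        if b ∈ S then 1 else swapSign (d b) ((L.filter (· ∈ S)).map d).sum := by
      rw [List.map_cons, List.prod_cons, if_neg (fun h => lt_irrefl _ h.1), one_mul]
      split_ifs with hb
      · exact List.prod_eq_one fun y hy => by
          obtain ⟨a, _, rfl⟩ := List.mem_map.mp hy
          simp [hb]
      · have hlt := hL.1
        clear ih hL
        induction L with
        | nil => simp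
        | cons c L ih =>
          rw [List.map_cons, List.prod_cons, ih fun a ha => hlt a (by simp [ha])]
          by_cases hc : c ∈ S
          · simp [hc, hb, hlt c (by simp), swapSign_add_right]
          · simp [hc]
    have h2 : (L.map fun b' => ((b :: L).map fun a =>
        if b' < a ∧ b' ∉ S ∧ a ∈ S then swapSign (d b') (d a) else 1).prod) =
        L.map fun b' => (L.map fun a =>
        if b' < a ∧ b' ∉ S ∧ a ∈ S then swapSign (d b') (d a) else 1).prod := by
      refine List.map_congr_left fun b' hb' => ?_
      rw [List.map_cons, List.prod_cons, if_neg (fun h => lt_asymm h.1 (hL.1 b' hb')), one_mul]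
    rw [List.map_cons, List.prod_cons, h1, h2, ← ih hL.2, unshuffleSign]

variable {M : Type*} [AddCommGroup M]

theorem Family.IsSymm.comp_map_eq_sum {q : Family M} (hq : q.IsSymm) (e : ℤ) (r : Family M)
    (x : Fin n → ℤ × M) {L : List (Fin n)} (hL : L.Nodup) :
    q.comp e r (L.map x) = ∑ S ∈ L.toFinset.powerset,
      unshuffleSign (fun a => (x a).1) S L •
        q ((e + wordDegree ((L.filter (· ∈ S)).map x), r ((L.filter (· ∈ S)).map x)) ::
          (L.filter (· ∉ S)).map x) := by
  induction L generalizing e q r with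
  | nil => simp [Family.comp_nil, unshuffleSign]
  | cons b L ih =>
    rw [List.nodup_cons] at hL
    have hb : b ∉ L.toFinset := by simpa using hL.1
    rw [List.toFinset_cons, Finset.sum_powerset_insert hb, List.map_cons, Family.comp_cons,
      ih hq _ _ hL.2, ih (hq.part (x b)) _ _ hL.2, add_comm, Finset.smul_sum]
    congr 1
    · refine Finset.sum_congr rfl fun S hS => ?_
      have hbS : b ∉ S := fun h => hb (Finset.mem_powerset.mp hS h)
      have h := hq [] (x b) (e + wordDegree ((L.filter (· ∈ S)).map x),
        r ((L.filter (· ∈ S)).map x)) ((L.filter (· ∉ S)).map x)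
      simp only [List.nil_append] at h
      have hdeg : (((L.filter (· ∈ S)).map fun a => (x a).1)).sum =
          wordDegree ((L.filter (· ∈ S)).map x) := by
        rw [wordDegree, List.map_map]; rfl
      simp only [List.filter_cons, hbS, decide_false, Bool.false_eq_true, if_false,
        not_false_eq_true, decide_true, if_true, List.map_cons, Family.part_apply, h,
        unshuffleSign, hdeg, swapSign_add_right, smul_smul]
      congr 1
      rcases swapSign_eq_one_or (x b).1 e with hs | hs <;> rw [hs] <;> ring
    · refine Finset.sum_congr rfl fun S hS => ?_
      have hmem (a) (ha : a ∈ L) : a ∈ S ↔ a ∈ insert b S := by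
        have : a ≠ b := fun h => hL.1 (h ▸ ha)
        simp [this]
      have h1 : L.filter (· ∈ insert b S) = L.filter (· ∈ S) :=
        List.filter_congr fun a ha => by simp only [hmem a ha]
      have h2 : L.filter (· ∉ insert b S) = L.filter (· ∉ S) :=
        List.filter_congr fun a ha => by simp only [hmem a ha]
      rw [List.filter_cons_of_pos (by simp), List.filter_cons_of_neg (by simp), h1, h2,
        unshuffleSign, if_pos (by simp), one_mul, unshuffleSign_congr _ hmem]
      simp [add_assoc]

/-- The set of values of a permutation on the first `k` indices. -/
def initialValues (k : ℕ) (σ : Equiv.Perm (Fin n)) : Finset (Fin n) :=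
  Finset.univ.filter fun a => (σ.symm a : ℕ) < k

theorem mem_initialValues {k : ℕ} {σ : Equiv.Perm (Fin n)} {a : Fin n} :
    a ∈ initialValues k σ ↔ (σ.symm a : ℕ) < k := by simp [initialValues]

theorem mem_shuffles {k : ℕ} {σ : Equiv.Perm (Fin n)} : σ ∈ shuffles n k ↔
    (∀ a b : Fin n, a < b → (b : ℕ) < k → σ a < σ b) ∧
      ∀ a b : Fin n, k ≤ (a : ℕ) → a < b → σ a < σ b := by simp [shuffles]

theorem filter_initialValues {k : ℕ} (hk : k ≤ n) {σ : Equiv.Perm (Fin n)}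
    (hσ : σ ∈ shuffles n k) :
    (List.finRange n).filter (· ∈ initialValues k σ) =
      List.ofFn fun j : Fin k => σ (j.castLE hk) := by
  refine List.SortedLT.eq_of_mem_iff ?_ ?_ fun a => ?_
  · exact ((List.pairwise_lt_finRange n).filter _).sortedLT
  · refine List.Pairwise.sortedLT (List.pairwise_ofFn.mpr fun i j hij => ?_)
    exact (mem_shuffles.mp hσ).1 _ _ hij j.isLt
  · simp only [List.mem_filter, List.mem_finRange, true_and, decide_eq_true_eq,
      mem_initialValues, List.mem_ofFn]
    constructor
    · exact fun h => ⟨⟨_, h⟩, by simp⟩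
    · rintro ⟨j, rfl⟩
      simp

theorem filter_not_initialValues {k : ℕ} (hk : k ≤ n) {σ : Equiv.Perm (Fin n)}
    (hσ : σ ∈ shuffles n k) :
    (List.finRange n).filter (· ∉ initialValues k σ) =
      List.ofFn fun j : Fin (n - k) => σ ⟨k + j, by omega⟩ := by
  refine List.SortedLT.eq_of_mem_iff ?_ ?_ fun a => ?_
  · exact ((List.pairwise_lt_finRange n).filter _).sortedLT
  · refine List.Pairwise.sortedLT (List.pairwise_ofFn.mpr fun i j hij => ?_)
    refine (mem_shuffles.mp hσ).2 _ _ (by simp) ?_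
    exact Fin.lt_def.mpr (Nat.add_lt_add_left hij k)
  · simp only [List.mem_filter, List.mem_finRange, true_and, decide_eq_true_eq,
      mem_initialValues, List.mem_ofFn, not_lt]
    constructor
    · intro h
      have := (σ.symm a).isLt
      refine ⟨⟨σ.symm a - k, by omega⟩, ?_⟩
      rw [← Equiv.eq_symm_apply]
      ext
      simp only
      omega
    · rintro ⟨j, rfl⟩
      simp

theorem koszulSign_shuffle (d : Fin n → ℤ) {k : ℕ} {σ : Equiv.Perm (Fin n)}
    (hσ : σ ∈ shuffles n k) :
    koszulSign d σ = unshuffleSign d (initialValues k σ) (List.finRange n) := by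
  rw [unshuffleSign_eq_prod _ _ (List.pairwise_lt_finRange n), ← Fin.prod_univ_def]
  simp only [← Fin.prod_univ_def]
  rw [koszulSign_eq_prod, Finset.prod_comm]
  refine Eq.trans (Finset.prod_congr rfl fun b _ => ?_) (Equiv.prod_comp σ _)
  refine Eq.trans (Finset.prod_congr rfl fun a _ => ?_) (Equiv.prod_comp σ _)
  rw [swapSign_comm]
  refine if_congr ?_ rfl rfl
  simp only [mem_initialValues, Equiv.symm_apply_apply, not_lt]
  rw [mem_shuffles] at hσ
  constructor
  · rintro ⟨h1, h2⟩
    refine ⟨h2, ?_, ?_⟩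
    · by_contra hb
      exact lt_asymm h2 (hσ.1 _ _ h1 (by omega))
    · by_contra ha
      exact lt_asymm h2 (hσ.2 _ _ (by omega) h1)
  · rintro ⟨h1, h2, h3⟩
    exact ⟨by rw [Fin.lt_def]; omega, h1⟩

/-- Shuffles correspond to subsets, by taking the values on the initial indices. -/
theorem sum_shuffles {N : Type*} [AddCommMonoid N] {k : ℕ} (hk : k ≤ n)
    (G : Finset (Fin n) → N) :
    ∑ σ ∈ shuffles n k, G (initialValues k σ) = ∑ S ∈ Finset.univ.powersetCard k, G S := by
  refine Finset.sum_nbij (initialValues k) (fun σ hσ => ?_) (fun σ hσ τ hτ h => ?_) ?_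
    fun σ _ => rfl
  · rw [Finset.mem_powersetCard]
    refine ⟨Finset.subset_univ _, ?_⟩
    have h1 := congrArg List.length (filter_initialValues hk hσ)
    have h2 : initialValues k σ =
        ((List.finRange n).filter (· ∈ initialValues k σ)).toFinset := by
      ext a; simp
    rw [h2, List.toFinset_card_of_nodup ((List.nodup_finRange n).filter _), h1, List.length_ofFn]
  · have h1 := filter_initialValues hk hσ
    have h2 := filter_not_initialValues hk hσ
    rw [h, filter_initialValues hk hτ] at h1
    rw [h, filter_not_initialValues hk hτ] at h2
    have h1 := List.ofFn_injective h1
    have h2 := List.ofFn_injective h2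
    ext a
    rcases lt_or_ge (a : ℕ) k with ha | ha
    · exact congrArg Fin.val (congrFun h1 ⟨a, ha⟩).symm
    · have := congrFun h2 ⟨a - k, by omega⟩
      have ha' : k + (a - k) = (a : ℕ) := by omega
      simp only [ha'] at this
      exact congrArg Fin.val this.symm
  · intro S hS
    rw [Finset.mem_coe, Finset.mem_powersetCard] at hS
    have hSc : Sᶜ.card = n - k := by rw [Finset.card_compl, hS.2, Fintype.card_fin]
    let σ : Equiv.Perm (Fin n) := (finCongr (by omega : n = k + (n - k))).trans
      (finSumFinEquiv.symm.trans (finSumEquivOfFinset hS.2 hSc))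
    have h1 (a : Fin n) (ha : (a : ℕ) < k) : σ a = S.orderEmbOfFin hS.2 ⟨a, ha⟩ := by
      have : finCongr (by omega : n = k + (n - k)) a = Fin.castAdd (n - k) ⟨a, ha⟩ := by
        ext; simp
      simp only [σ, Equiv.trans_apply, this, finSumFinEquiv_symm_apply_castAdd,
        finSumEquivOfFinset_inl]
    have h2 (a : Fin n) (ha : k ≤ (a : ℕ)) :
        σ a = Sᶜ.orderEmbOfFin hSc ⟨a - k, by omega⟩ := by
      have : finCongr (by omega : n = k + (n - k)) a = Fin.natAdd k ⟨a - k, by omega⟩ := by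
        ext; simp; omega
      simp only [σ, Equiv.trans_apply, this, finSumFinEquiv_symm_apply_natAdd,
        finSumEquivOfFinset_inr]
    refine ⟨σ, mem_shuffles.mpr ⟨fun a b hab hb => ?_, fun a b ha hab => ?_⟩, ?_⟩
    · rw [h1 a (by omega), h1 b hb]
      simpa using hab
    · rw [h2 a ha, h2 b (by omega)]
      simp only [OrderEmbedding.lt_iff_lt, Fin.lt_def]
      omega
    · ext a
      obtain ⟨b, rfl⟩ := σ.surjective a
      rw [mem_initialValues, Equiv.symm_apply_apply]
      rcases lt_or_ge (b : ℕ) k with hb | hb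
      · simp [hb, h1 b hb]
      · have := Sᶜ.orderEmbOfFin_mem hSc ⟨b - k, by omega⟩
        rw [← h2 b hb, Finset.mem_compl] at this
        simp [this, hb]

/-- The square of a symmetric family is the left-hand side of the higher Jacobi identity. -/
theorem Family.IsSymm.comp_self_ofFn {q : Family M} (hq : q.IsSymm)
    (h0 : ∀ w, q ((1, q []) :: w) = 0) (x : Fin n → ℤ × M) :
    q.comp 1 q (List.ofFn x) = ∑ i : Fin n, ∑ σ ∈ shuffles n (i + 1),
      koszulSign (fun a => (x a).1) σ •
        q ((1 + wordDegree (List.ofFn fun a : Fin (i + 1) => x (σ (a.castLE i.isLt))),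
          q (List.ofFn fun a : Fin (i + 1) => x (σ (a.castLE i.isLt)))) ::
          List.ofFn fun b : Fin (n - (i + 1)) => x (σ ⟨i + 1 + b, by omega⟩)) := by
  let G : Finset (Fin n) → M := fun S =>
    unshuffleSign (fun a => (x a).1) S (List.finRange n) •
      q ((1 + wordDegree (((List.finRange n).filter (· ∈ S)).map x),
        q (((List.finRange n).filter (· ∈ S)).map x)) ::
        ((List.finRange n).filter (· ∉ S)).map x)
  have h1 : q.comp 1 q (List.ofFn x) = ∑ S ∈ Finset.univ.powerset, G S := by
    rw [List.ofFn_eq_map, hq.comp_map_eq_sum 1 q x (List.nodup_finRange n),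
      List.toFinset_finRange]
  rw [h1, Finset.sum_powerset, Finset.card_univ, Fintype.card_fin, Finset.sum_range_succ',
    Finset.powersetCard_zero, Finset.sum_singleton]
  have hG0 : G ∅ = 0 := by simp [G, h0]
  rw [hG0, add_zero, Finset.sum_range]
  refine Finset.sum_congr rfl fun i _ => ?_
  rw [← sum_shuffles i.isLt]
  refine Finset.sum_congr rfl fun σ hσ => ?_
  simp only [G]
  rw [koszulSign_shuffle _ hσ, filter_initialValues i.isLt hσ,
    filter_not_initialValues i.isLt hσ, List.map_ofFn, List.map_ofFn]
  rfl

end Shuffles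

/-! ### From families to multilinear brackets -/

section Globalize

theorem Family.apply_ofFn_update {M : Type*} {k : ℕ} (q : Family M) (f : Fin k → ℤ × M)
    (a : Fin k) (v : ℤ × M) : q (List.ofFn (Function.update f a v)) =
      q ((List.ofFn f).take a ++ v :: (List.ofFn f).drop (a + 1)) := by
  congr 1
  refine List.ext_getElem (by simp; omega) fun j h1 h2 => ?_
  rw [List.length_ofFn] at h1
  rw [List.getElem_ofFn, Function.update_apply, List.getElem_append]
  rcases lt_trichotomy j a with h | h | h
  · simp [h, Fin.ext_iff, h.ne]
  · subst h; simp
  · have h3 : j - a = (j - a - 1) + 1 := by omega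
    simp only [Fin.ext_iff, h.ne', if_false, List.length_take, List.length_ofFn,
      min_eq_left a.isLt.le, h.not_gt, dite_false]
    rw [List.getElem_cons, dif_neg (by omega)]
    simp only [List.getElem_drop, List.getElem_ofFn]
    congr 2
    omega

variable {K O M : Type*} [Field K] [CommRing O] [Algebra K O] [AddCommGroup M] [Module K M]
  [Module O M] [IsScalarTower K O M] {𝓔 : ℤ → Submodule O M} {p : ℤ → M →ₗ[O] M}
  {d : M →ₗ[O] M} {β : M → M → M} {ρ : M →ₗ[O] Derivation K O O} {q : Family M}

theorem IsBracketFamily.sum_piFinset_eq {a : ℤ} (hq : IsBracketFamily p a q) {k : ℕ}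
    (x : Fin k → M) {s t : Fin k → Finset ℤ} (hst : ∀ b, s b ⊆ t b)
    (hs : ∀ b i, p i (x b) ≠ 0 → i ∈ s b) :
    ∑ δ ∈ Fintype.piFinset t, q (List.ofFn fun b => (δ b, x b)) =
      ∑ δ ∈ Fintype.piFinset s, q (List.ofFn fun b => (δ b, x b)) := by
  symm
  refine Finset.sum_subset (Fintype.piFinset_subset _ _ hst) fun δ _ hδ => ?_
  rw [Fintype.mem_piFinset, not_forall] at hδ
  obtain ⟨b, hb⟩ := hδ
  have h0 : p (δ b) (x b) = 0 := by
    by_contra h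
    exact hb (hs b _ h)
  obtain ⟨u, v, huv⟩ := List.append_of_mem
    (List.mem_ofFn.mpr ⟨b, rfl⟩ : (δ b, x b) ∈ List.ofFn fun b => (δ b, x b))
  rw [huv]
  exact hq.proj u _ _ v h0

/-- The multilinear maps obtained by decomposing all arguments into homogeneous components. -/
theorem exists_multilinearMap (hp : IsGradedProjection 𝓔 p) {a : ℤ}
    (hq : IsBracketFamily p a q)
    (hK : ∀ u i (r : K) x v, q (u ++ (i, r • x) :: v) = r • q (u ++ (i, x) :: v)) (k : ℕ) :
    ∃ B : MultilinearMap K (fun _ : Fin k => M) M, ∀ (x : Fin k → M) (t : Fin k → Finset ℤ),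
      (∀ b i, p i (x b) ≠ 0 → i ∈ t b) →
      B x = ∑ δ ∈ Fintype.piFinset t, q (List.ofFn fun b => (δ b, x b)) := by
  let S : M → Finset ℤ := fun x => (hp.finite x).toFinset
  have hS (x : M) (i : ℤ) : p i x ≠ 0 → i ∈ S x := fun h => by simpa [S] using h
  have hS' (x : M) (i : ℤ) : i ∈ S x → p i x ≠ 0 := fun h => by simpa [S] using h
  let F : (Fin k → M) → M := fun x =>
    ∑ δ ∈ Fintype.piFinset (fun b => S (x b)), q (List.ofFn fun b => (δ b, x b))
  have hF (x : Fin k → M) (t : Fin k → Finset ℤ) (ht : ∀ b i, p i (x b) ≠ 0 → i ∈ t b) :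
      F x = ∑ δ ∈ Fintype.piFinset t, q (List.ofFn fun b => (δ b, x b)) :=
    (hq.sum_piFinset_eq x (fun b i hi => ht b i (hS' _ _ hi)) fun b => hS _).symm
  have hupd (δ : Fin k → ℤ) (x : Fin k → M) (b : Fin k) (y : M) :
      (fun j => (δ j, Function.update x b y j)) =
        Function.update (fun j => (δ j, x j)) b (δ b, y) := by
    funext j
    by_cases h : j = b
    · subst h; simp
    · simp [h]
  refine ⟨MultilinearMap.mk' F (fun x b y z => ?_) (fun x b r y => ?_), hF⟩
  · let t : Fin k → Finset ℤ := Function.update (fun j => S (x j)) b (S y ∪ S z)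
    have ht (v : M) (hv : ∀ i, p i v ≠ 0 → i ∈ S y ∪ S z) (j : Fin k) (i : ℤ)
        (h : p i (Function.update x b v j) ≠ 0) : i ∈ t j := by
      by_cases hj : j = b
      · subst hj
        simp only [Function.update_self, t] at h ⊢
        exact hv i h
      · simp only [Function.update_of_ne hj, t] at h ⊢
        exact hS _ _ h
    rw [hF _ t (ht y fun i h => Finset.mem_union_left _ (hS _ _ h)),
      hF _ t (ht z fun i h => Finset.mem_union_right _ (hS _ _ h)), hF _ t,
      ← Finset.sum_add_distrib]
    · refine Finset.sum_congr rfl fun δ _ => ?_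
      simp only [hupd, Family.apply_ofFn_update]
      exact hq.add _ _ _ _ _
    · refine ht _ fun i h => ?_
      rw [map_add] at h
      by_cases hy : p i y = 0
      · rw [hy, zero_add] at h
        exact Finset.mem_union_right _ (hS _ _ h)
      · exact Finset.mem_union_left _ (hS _ _ hy)
  · rw [hF _ (fun j => S (Function.update x b y j))]
    · simp only [F, Finset.smul_sum]
      refine Finset.sum_congr rfl fun δ _ => ?_
      simp only [hupd, Family.apply_ofFn_update, hK]
    · intro j i h
      apply hS
      by_cases hj : j = b
      · subst hj
        simp only [Function.update_self] at h ⊢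
        intro h0
        rw [← algebraMap_smul O r y, map_smul, h0, smul_zero] at h
        exact h rfl
      · simpa only [Function.update_of_ne hj] using h

theorem IsPrebracket.map_smul_scalar (hq : IsPrebracket p d β ρ q) (u : List (ℤ × M)) (i : ℤ)
    (r : K) (x : M) (v : List (ℤ × M)) :
    q (u ++ (i, r • x) :: v) = r • q (u ++ (i, x) :: v) := by
  rw [hq.family.symm.move_last, hq.family.symm.move_last u v (i, x), ← algebraMap_smul O r x,
    hq.symbol, Derivation.map_algebraMap, zero_smul, add_zero, smul_comm]
  exact algebraMap_smul O r _

/-- Brackets satisfying the higher Jacobi identities form a Lie `∞`-algebroid. -/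
theorem IsPrebracket.exists_lieInftyAlgebroid (hC : IsAlgebroidComplex 𝓔 p d β ρ)
    (hgr : IsNegativelyGraded 𝓔) (hproj : ∀ i, Module.Projective O (𝓔 i))
    (hq : IsPrebracket p d β ρ q) (hJ : ∀ w, q.comp 1 q w = 0) :
    ∃ L : LieInftyAlgebroid K 𝓔, L.anchor = ρ ∧ L.unary = d ∧
      ∀ (k : ℕ) (g : Fin k → ℤ) (x : Fin k → M), (∀ a, x a ∈ 𝓔 (g a)) →
        L.bracket k x = q (List.ofFn fun a => (g a, x a)) := by
  have hp := hC.proj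
  choose B hB using fun k => exists_multilinearMap (K := K) hp hq.family hq.map_smul_scalar k
  have hhom (k : ℕ) (g : Fin k → ℤ) (x : Fin k → M) (hx : ∀ a, x a ∈ 𝓔 (g a)) :
      B k x = q (List.ofFn fun a => (g a, x a)) := by
    rw [hB k x (fun a => {g a}), Fintype.piFinset_singleton, Finset.sum_singleton]
    intro b i h
    rw [Finset.mem_singleton]
    by_contra hne
    exact h (hp.of_mem_ne _ _ hne _ (hx b))
  have hdeg (k : ℕ) (g : Fin k → ℤ) (x : Fin k → M) :
      wordDegree (List.ofFn fun a => (g a, x a)) = ∑ a, g a := by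
    rw [wordDegree, List.map_ofFn, List.sum_ofFn]
    rfl
  have hunary (x : M) : B 1 ![x] = d x := by
    rw [hB 1 ![x] (fun _ => (hp.finite x).toFinset)]
    · conv_rhs => rw [← hp.sum x (hp.finite x).toFinset (fun i h => by simpa using h), map_sum]
      refine Finset.sum_nbij' (fun δ => δ 0) (fun i _ => i) (fun δ hδ => ?_) (fun i hi => ?_)
        (fun δ _ => ?_) (fun i _ => rfl) fun δ _ => ?_
      · exact Fintype.mem_piFinset.mp hδ 0
      · exact Fintype.mem_piFinset.mpr fun _ => hi
      · funext a
        rw [Subsingleton.elim a 0]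
      · rw [← hq.unary]
        simp
    · intro b i h
      rw [Subsingleton.elim b 0] at h
      simpa using h
  have hbin (x y : M) (s t : Finset ℤ) (hs : ∀ i, p i x ≠ 0 → i ∈ s)
      (ht : ∀ i, p i y ≠ 0 → i ∈ t) :
      B 2 ![x, y] = ∑ i ∈ s, ∑ j ∈ t, q [(i, x), (j, y)] := by
    rw [hB 2 ![x, y] ![s, t], ← Finset.sum_product']
    · refine Finset.sum_nbij' (fun δ => (δ 0, δ 1)) (fun i => ![i.1, i.2]) (fun δ hδ => ?_)
        (fun i hi => ?_) (fun δ _ => ?_) (fun i _ => rfl) fun δ _ => ?_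
      · rw [Fintype.mem_piFinset] at hδ
        exact Finset.mem_product.mpr ⟨hδ 0, hδ 1⟩
      · rw [Finset.mem_product] at hi
        rw [Fintype.mem_piFinset, Fin.forall_fin_two]
        exact hi
      · funext a
        fin_cases a <;> rfl
      · simp
    · rw [Fin.forall_fin_two]
      exact ⟨hs, ht⟩
  let L : LieInftyAlgebroid K 𝓔 :=
    { graded := hgr
      projective := hproj
      bracket := B
      anchor := ρ
      anchor_eq_zero := fun i hi x hx => hC.ρ_proj x (hp.of_mem_ne i (-1) hi.symm x hx)
      bracket_mem := fun k g x hx => by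
        have := hq.family.mem hp (List.ofFn fun a => (g a, x a))
        rwa [hdeg, add_comm, ← hhom k g x hx] at this
      bracket_perm := fun k g x hx σ => by
        rw [hhom k g x hx, hhom k (fun a => g (σ a)) (fun a => x (σ a)) fun a => hx (σ a)]
        exact hq.family.symm.apply_perm (fun a => (g a, x a)) σ
      jacobi := fun n g x hx => by
        have h0 : q [] = 0 := hq.family.eq_zero_of_degree hC.proj_nonneg (by simp)
        have hsum := hq.family.symm.comp_self_ofFn (n := n)
          (fun w => by rw [h0]; exact hq.family.add.map_zero [] w 1) fun a => (g a, x a)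
        rw [hJ] at hsum
        rw [hsum]
        refine Finset.sum_congr rfl fun i _ => Finset.sum_congr rfl fun σ _ => ?_
        congr 1
        rw [hhom (i + 1) (fun a => g (σ (a.castLE i.isLt))) _ fun a => hx _]
        set u : List (ℤ × M) := List.ofFn fun a : Fin (i + 1) =>
          (g (σ (a.castLE i.isLt)), x (σ (a.castLE i.isLt)))
        rw [hhom _ (Fin.cons (1 + wordDegree u)
          fun b : Fin (n - (i + 1)) => g (σ ⟨i + 1 + b, by omega⟩))]
        · congr 1
          rw [List.ofFn_succ]
          simp
        · intro a
          refine Fin.cases ?_ (fun b => ?_) a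
          · exact hq.family.mem hp u
          · exact hx _
      bracket_smul := fun k hk x a f y => by
        have hupd (δ : Fin k → ℤ) (z : M) : (fun j => (δ j, Function.update x a z j)) =
            Function.update (fun j => (δ j, x j)) a (δ a, z) := by
          funext j
          by_cases h : j = a
          · subst h; simp
          · simp [h]
        let t : Fin k → Finset ℤ := fun j => (hp.finite (Function.update x a y j)).toFinset
        rw [hB k (Function.update x a y) t (fun j i h => by simpa [t] using h),
          hB k (Function.update x a (f • y)) t, Finset.smul_sum]
        · refine Finset.sum_congr rfl fun δ _ => ?_
          simp only [hupd, Family.apply_ofFn_update]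
          refine hq.map_smul_of_length_ne_two ?_ _ _ _
          simp only [List.length_append, List.length_take, List.length_drop, List.length_ofFn]
          omega
        · intro j i h
          have : p i (Function.update x a y j) ≠ 0 := by
            by_cases hj : j = a
            · subst hj
              simp only [Function.update_self, map_smul] at h ⊢
              exact fun h0 => h (by rw [h0, smul_zero])
            · simpa only [Function.update_of_ne hj] using h
          simpa [t] using this
      leibniz := fun x y f => by
        let s : Finset ℤ := insert (-1) (hp.finite x).toFinset
        let t : Finset ℤ := (hp.finite y).toFinset
        have hs (i) (h : p i x ≠ 0) : i ∈ s := by simp [s, h]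
        have ht (i) (h : p i y ≠ 0) : i ∈ t := by simpa [t] using h
        have ht' (i) (h : p i (f • y) ≠ 0) : i ∈ t := by
          refine ht i fun h0 => h ?_
          rw [map_smul, h0, smul_zero]
        have hsym (i j : ℤ) : q [(i, x), (j, f • y)] =
            f • q [(i, x), (j, y)] + (if i = -1 then ρ x else 0 : Derivation K O O) f • p j y :=
          hq.symbol [(i, x)] j f y
        rw [hbin x (f • y) s t hs ht', hbin x y s t hs ht]
        simp only [hsym, Finset.sum_add_distrib, ← Finset.smul_sum, hp.sum y t ht]
        rw [add_comm, ← Finset.sum_smul]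
        congr 2
        rw [Finset.sum_eq_single (-1)]
        · simp
        · intro i _ hi
          simp [hi]
        · intro h
          exact absurd (Finset.mem_insert_self _ _) h
      anchor_unary := fun x hx => by rw [hunary]; exact hC.ρ_d x hx
      anchor_bracket := fun x hx y hy => by
        rw [hhom 2 ![-1, -1] ![x, y] (by rw [Fin.forall_fin_two]; exact ⟨hx, hy⟩), ← hC.ρ_β,
          ← hq.binary]
        simp }
  exact ⟨L, rfl, LinearMap.ext hunary, hhom⟩

end Globalize

/-! ### Lie algebroids over a resolution -/

theorem mainTheorem7 {K O M A : Type*} [Field K] [CharZero K] [CommRing O] [Algebra K O]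
    [AddCommGroup M] [Module K M] [Module O M] [IsScalarTower K O M]
    [LieRing A] [LieAlgebra K A] [Module O A] [LieRingModule A O]
    [LieRinehartRing O A] [LieRinehartAlgebra K O A]
    (𝓔 : ℤ → Submodule O M) (d : M →ₗ[O] M) (π : 𝓔 (-1) →ₗ[O] A)
    (hres : IsFreeResolution 𝓔 d π)
    (S : LieAlgebroidStructure K O (𝓔 (-1))) (hS : S.IsMorphism π) :
    ∃ L : LieInftyAlgebroid K 𝓔,
      L.unary = d ∧
      L.IsUniversal π ∧
      (∀ x y : 𝓔 (-1), L.binary x y = S.bracket x y) ∧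
      ∀ k : ℕ, 3 ≤ k → ∀ x : Fin k → 𝓔 (-1), L.bracket k (fun a => (x a : M)) = 0 := by
  obtain ⟨p, hp⟩ := hres.graded.isInternal.exists_isGradedProjection
  have hneg (i : ℤ) (hi : 0 ≤ i) (x : M) : p i x = 0 := by
    have := hp.mem i x
    rwa [hres.graded.eq_bot i hi, Submodule.mem_bot] at this
  let P (i : ℤ) : M →ₗ[O] 𝓔 i := (p i).codRestrict (𝓔 i) (hp.mem i)
  have hP (i : ℤ) (x : M) : ((P i x : 𝓔 i) : M) = p i x := rfl
  have hPmem (i : ℤ) (x : 𝓔 i) : P i x = x := Subtype.ext (hp.of_mem i x x.2)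
  have hP0 (i : ℤ) (x : M) (h : p i x = 0) : P i x = 0 := Subtype.ext h
  let β : M → M → M := fun x y => (S.bracket (P (-1) x) (P (-1) y) : 𝓔 (-1))
  let ρ : M →ₗ[O] Derivation K O O := S.anchor ∘ₗ P (-1)
  have hskew (x y : 𝓔 (-1)) : S.bracket x y = -S.bracket y x := by
    have h := S.bracket_self (x + y)
    simp only [map_add, LinearMap.add_apply, S.bracket_self, zero_add, add_zero] at h
    exact eq_neg_of_add_eq_zero_left (by rw [add_comm]; exact h)
  have hbd (y : M) (hy : y ∈ 𝓔 (-2)) : π (P (-1) (d y)) = 0 := by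
    rw [hres.exact_hook]
    exact ⟨y, hy, (hp.of_mem (-1) _ (hres.map_mem (-2) y hy)).symm⟩
  have hC : IsAlgebroidComplex 𝓔 p d β ρ :=
    { proj := hp
      proj_nonneg := hneg
      d_mem := hres.map_mem
      d_d := fun i x hx => by
        rcases le_or_gt (i + 1) (-2) with h | h
        · exact (hres.exact (i + 1) h (d x) (hres.map_mem i x hx)).mpr
            ⟨x, by rwa [add_sub_cancel_right], rfl⟩
        · have := hres.map_mem _ _ (hres.map_mem i x hx)
          rwa [hres.graded.eq_bot _ (by omega), Submodule.mem_bot] at this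
      exact := fun i hi x hx h => (hres.exact i hi x hx).mp h
      ideal := fun x y hy => by
        have h : π (S.bracket (P (-1) x) (P (-1) (d y))) = 0 := by
          rw [hS.map_bracket, hbd y hy, lie_zero]
        obtain ⟨z, hz, hzd⟩ := (hres.exact_hook _).mp h
        exact ⟨z, hz, hzd⟩
      β_add := fun x y z => by simp [β]
      β_skew := fun x y => by
        simp only [β]
        rw [hskew, Submodule.coe_neg]
      β_mem := fun x y => Submodule.coe_mem _
      β_proj := fun x y h => by simp [β, hP0 _ _ h]
      β_smul := fun x y f => by
        simp only [β, map_smul, S.leibniz, ρ, LinearMap.comp_apply]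
        rw [add_comm]
        rfl
      β_jacobi := fun x y z => by
        simp only [β, hPmem]
        exact congrArg Subtype.val (S.jacobi (P (-1) x) (P (-1) y) (P (-1) z))
      ρ_proj := fun x h => by simp [ρ, hP0 _ _ h]
      ρ_d := fun y hy => by
        simp only [ρ, LinearMap.comp_apply, ← hS.map_anchor, hbd y hy]
        exact map_zero (LieRinehartAlgebra.anchor K O A).toLieHom
      ρ_β := fun x y => by
        simp only [ρ, β, LinearMap.comp_apply, hPmem, S.anchor_bracket] }
  have hfree := hres.free
  let b (i : ℤ) := Module.Free.chooseBasis O (𝓔 i)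
  obtain ⟨q, hq, hJ⟩ := exists_isPrebracket_comp_eq_zero hC
    (c := fun i => (b i).repr.toLinearMap ∘ₗ P i) (e := fun i j => (b i j : M))
    (fun i x => by
      have h := congrArg (𝓔 i).subtype ((b i).linearCombination_repr (P i x))
      rw [Finsupp.linearCombination_apply, Finsupp.sum, map_sum] at h
      simpa [Finsupp.linearCombination_apply, Finsupp.sum, hP] using h)
    (fun i x h => by simp [hP0 i x h]) fun i j => Submodule.coe_mem _
  obtain ⟨L, hLa, hLu, hLb⟩ := hq.exists_lieInftyAlgebroid hC hres.graded
    (fun i => inferInstance) hJ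
  have hbin (x y : 𝓔 (-1)) : L.binary x y = S.bracket x y := by
    refine Subtype.ext ?_
    have h := hLb 2 ![-1, -1] ![(x : M), (y : M)] (by
      rw [Fin.forall_fin_two]; exact ⟨x.2, y.2⟩)
    refine h.trans ?_
    have h2 : β x y = (S.bracket x y : 𝓔 (-1)) := by simp only [β, hPmem]
    rw [← h2, ← hq.binary]
    simp
  refine ⟨L, hLu, ⟨⟨fun x => ?_, fun x y => ?_⟩, ?_⟩, hbin, fun k hk x => ?_⟩
  · rw [hS.map_anchor, hLa]
    simp only [ρ, LinearMap.comp_apply, hPmem]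
  · rw [hbin, hS.map_bracket]
  · rw [hLu]
    exact hres.toIsResolution
  · rw [hLb k (fun _ => -1) _ fun a => (x a).2]
    refine hq.higher _ (by simpa using hk) fun a ha => ?_
    obtain ⟨j, rfl⟩ := List.mem_ofFn.mp ha
    rfl
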